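/- Let $K$ be a number field with ring of integers $\mathcal{O}_K$ and $m=[K:\mathbb{Q}]$, and let $A$ be a finite-dimensional division algebra with center $K$ and $[A:K]=n^2$. Let $\mathcal{O}\subset A$ be an $\mathcal{O}_K$-order, i.e. a subring containing $\mathcal{O}_K$, finitely generated as an $\mathcal{O}_K$-module, with $K\mathcal{O}=A$. Let $t\ge 2$ and $k$ be integers with $(n-1)t<k<nt$, and put $d=n^2mt$. Let $P$ be an infinite set of nonzero primes $\mathfrak{p}$ of $\mathcal{O}_K$ and, for each $\mathfrak{p}\in P$, write $\mathbb{F}_q=\mathcal{O}_K/\mathfrak{p}$, let $p$ be the characteristic of $\mathbb{F}_q$, and let $\varphi_{\mathfrak{p}}:\mathcal{O}\to M_n(\mathbb{F}_q)$ be a surjective ring homomorphism with kernel $\mathfrak{p}\mathcal{O}$. Let $\phi_{p}:\mathcal{O}^t\to M_n(\mathbb{F}_q)^t$ be $\varphi_{\mathfrak{p}}$ in each coordinate. Fix an $\mathbb{R}$-linear isomorphism $(A\otimes_{\mathbb{Q}}\mathbb{R})^t\cong\mathbb{R}^{d}$ (for example an isometry for a Euclidean structure on $(A\otimes_{\mathbb{Q}}\mathbb{R})^t$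 given by the trace form of a positive involution), and let $i:A^t\to(A\otimes_{\mathbb{Q}}\mathbb{R})^t\cong\mathbb{R}^{d}$ be the resulting coordinate-wise embedding. Let $V$ be the covolume of $i(\mathcal{O}^t)$ in $\mathbb{R}^{d}$. Set $$\mathcal{C}_{k,p}=\{C\subseteq M_n(\mathbb{F}_q)^{t}\mid C\text{ is a left }M_n(\mathbb{F}_q)\text{-submodule isomorphic to }(\mathbb{F}_q^{\,n})^{\oplus k}\},$$ $$\mathbb{L}_{k,p}=\{\beta_p\, i(\phi_p^{-1}(C))\mid C\in\mathcal{C}_{k,p}\},\qquad \beta_p=q^{\frac{nk-n^2t}{n^2mt}}.$$ For a lattice $\Lambda\subset\mathbb{R}^d$ let $\Lambda'$ be the set of its primitive vectors, i.e. the nonzero vectors of $\Lambda$ that are shortest among the nonzero vectors of $\Lambda$ on the real line they span. Let $f:\mathbb{R}^{d}\to\mathbb{R}$ be semi-admissible, i.e. $f$ is Riemann-integrable and there are constants $b,\delta>0$ with $|f(x)|\le b\,(1+\|x\|)^{-(d+\delta)}$ for all $x$. Then $f$ is Lebesgue integrable; every $\mathbb{L}_{k,p}$ is finite and non-empty; all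 $\Lambda\in\mathbb{L}_{k,p}$ have covolume $V$, with $\sum_{x\in\Lambda'}f(x)$ absolutely convergent; and the limit of the averages below, as $p\to\infty$ along the primes $\mathfrak{p}\in P$, exists and satisfies $$\lim_{p\to\infty}\ \frac{1}{|\mathbb{L}_{k,p}|}\sum_{\Lambda\in\mathbb{L}_{k,p}}\ \sum_{x\in\Lambda'}f(x)\ \le\ \frac{1}{\zeta(d)\,V}\int_{\mathbb{R}^{d}}f(x)\,dx .$$ -/

import Mathlib

open NumberField MeasureTheory Filter Topology
open scoped TensorProduct Pointwise

noncomputable section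

namespace CodeLift

/-- Riemann-integrability over a compact box, with Mathlib's Riemann integral, for every box.
Together with a decay condition at infinity this is Riemann-integrability on the whole space. -/
def IsRiemannIntegrable {d : ℕ} (f : EuclideanSpace ℝ (Fin d) → ℝ) : Prop :=
  ∀ I : BoxIntegral.Box (Fin d),
    BoxIntegral.Integrable I BoxIntegral.IntegrationParams.Riemann
      (fun x : Fin d → ℝ => f (WithLp.toLp 2 x)) BoxIntegral.BoxAdditiveMap.volume

/-- Semi-admissible functions: Riemann-integrable, with `|f x| ≤ b / (1 + ‖x‖) ^ (d + δ)`. -/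
structure IsSemiAdmissible {d : ℕ} (f : EuclideanSpace ℝ (Fin d) → ℝ) : Prop where
  riemann : IsRiemannIntegrable f
  decay : ∃ b δ : ℝ, 0 < b ∧ 0 < δ ∧ ∀ x, |f x| ≤ b / (1 + ‖x‖) ^ ((d : ℝ) + δ)

/-- The subring `O` (containing `𝓞 K`) is an `𝓞 K`-order in the `K`-algebra `A`: it is finitely
generated as an `𝓞 K`-module and `K • O = A`. -/
structure IsOrderIn {K A : Type*} [Field K] [NumberField K] [Ring A] [Algebra K A]
    (O : Subalgebra (𝓞 K) A) : Prop where
  fg : (Subalgebra.toSubmodule O).FG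
  span_eq_top : Submodule.span K (O : Set A) = ⊤

/-- A ring homomorphism `φ : O → M_n(𝓞 K / 𝔭)` is a reduction map at `𝔭` if it is surjective with
kernel `𝔭 O`, i.e. if it is the quotient map `O → O / 𝔭 O` followed by a ring isomorphism
`O / 𝔭 O ≃ M_n(𝓞 K / 𝔭)`. -/
structure IsReductionMap {K A : Type*} [Field K] [NumberField K] [Ring A] [Algebra K A]
    {O : Subalgebra (𝓞 K) A} {𝔭 : Ideal (𝓞 K)} {n : ℕ}
    (φ : O →+* Matrix (Fin n) (Fin n) (𝓞 K ⧸ 𝔭)) : Prop where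
  surjective : Function.Surjective φ
  ker_eq : RingHom.ker φ = 𝔭.map (algebraMap (𝓞 K) O)

/-- The codes: submodules of `M_n(F)^t` over `M_n(F)` isomorphic to `(F ^ n) ^ k`, where `M_n(F)`
acts on `F ^ n` by matrix-vector multiplication. -/
def codes (F : Type*) [CommRing F] (n t k : ℕ) :
    Set (Submodule (Matrix (Fin n) (Fin n) F) (Fin t → Matrix (Fin n) (Fin n) F)) :=
  {C | Nonempty (C ≃ₗ[Matrix (Fin n) (Fin n) F] (Fin k → Fin n → F))}

section Lattices

variable {K A : Type*} [Field K] [NumberField K] [DivisionRing A] [Algebra K A] [Algebra ℚ A]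
  {O : Subalgebra (𝓞 K) A} {t d : ℕ}

/-- The embedding `O ^ t ⊆ A ^ t → (ℝ ⊗ A) ^ t ≃ ℝ ^ d`, where the first map is `a ↦ 1 ⊗ a` in
each coordinate and the second one is a chosen linear identification `ψ`. -/
def embed (O : Subalgebra (𝓞 K) A)
    (ψ : (Fin t → ℝ ⊗[ℚ] A) ≃ₗ[ℝ] EuclideanSpace ℝ (Fin d)) :
    (Fin t → O) →+ EuclideanSpace ℝ (Fin d) where
  toFun x := ψ fun i => (1 : ℝ) ⊗ₜ[ℚ] (x i : A)
  map_zero' := by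
    have h : (fun _ : Fin t => (1 : ℝ) ⊗ₜ[ℚ] (((0 : O) : A))) = 0 := by
      funext i; simp
    exact (congrArg ψ h).trans (map_zero ψ)
  map_add' x y := by
    rw [← map_add]
    congr 1
    funext i
    simp [TensorProduct.tmul_add]

/-- The image of `O ^ t` in `ℝ ^ d`. -/
def orderLattice (O : Subalgebra (𝓞 K) A)
    (ψ : (Fin t → ℝ ⊗[ℚ] A) ≃ₗ[ℝ] EuclideanSpace ℝ (Fin d)) :
    Submodule ℤ (EuclideanSpace ℝ (Fin d)) :=
  (embed O ψ).range.toIntSubmodule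

/-- The image in `ℝ ^ d` of the preimage of the code `C` under the coordinate-wise reduction map
`O ^ t → M_n(F) ^ t`. -/
def codeLattice {F : Type*} [CommRing F] {n : ℕ}
    (ψ : (Fin t → ℝ ⊗[ℚ] A) ≃ₗ[ℝ] EuclideanSpace ℝ (Fin d))
    (φ : O →+* Matrix (Fin n) (Fin n) F)
    (C : Submodule (Matrix (Fin n) (Fin n) F) (Fin t → Matrix (Fin n) (Fin n) F)) :
    Submodule ℤ (EuclideanSpace ℝ (Fin d)) :=
  ((C.toAddSubgroup.comap (φ.toAddMonoidHom.compLeft (Fin t))).map (embed O ψ)).toIntSubmodule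

/-- The scaling factor `β = q ^ ((n k - n² t) / (n² m t))`, where `q` is the cardinality of the
residue field `F`. -/
def scaling (F : Type*) (n m t k : ℕ) : ℝ :=
  (Nat.card F : ℝ) ^ (((n : ℝ) * k - (n : ℝ) ^ 2 * t) / ((n : ℝ) ^ 2 * m * t))

/-- The set of rescaled preimages `β φ⁻¹(C)`, for `C` running over the codes. -/
def liftedLattices {F : Type*} [CommRing F] {n : ℕ} (m k : ℕ)
    (ψ : (Fin t → ℝ ⊗[ℚ] A) ≃ₗ[ℝ] EuclideanSpace ℝ (Fin d))
    (φ : O →+* Matrix (Fin n) (Fin n) F) :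
    Set (Submodule ℤ (EuclideanSpace ℝ (Fin d))) :=
  {Λ | ∃ C ∈ codes F n t k, Λ = scaling F n m t k • codeLattice ψ φ C}

end Lattices

/-- The primitive vectors of `Λ`: the nonzero lattice vectors that are shortest among the nonzero
lattice vectors on the real line they span. -/
def primitiveVectors {d : ℕ} (Λ : Submodule ℤ (EuclideanSpace ℝ (Fin d))) :
    Set (EuclideanSpace ℝ (Fin d)) :=
  {x | x ∈ Λ ∧ x ≠ 0 ∧ ∀ y ∈ Λ, y ≠ 0 → y ∈ Submodule.span ℝ {x} → ‖x‖ ≤ ‖y‖}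

/-- The average, over the members `Λ` of a finite set of lattices (with the uniform weights), of
the sum of `f` over the primitive vectors of `Λ`. -/
def averagePrimitiveSum {d : ℕ} (𝕃 : Set (Submodule ℤ (EuclideanSpace ℝ (Fin d))))
    (f : EuclideanSpace ℝ (Fin d) → ℝ) : ℝ :=
  (∑ᶠ Λ ∈ 𝕃, ∑' x : primitiveVectors Λ, f x) / (𝕃.ncard : ℝ)

end CodeLift

end

/-!
The averages converge, and their limit is equal to the asserted bound. Write `q` for the cardinality
of the residue field, `β` for the scaling factor, and view an element of `M_n(𝔽_q) ^ t` as an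
`n × tn` matrix.

*Codes are subspaces.* Every submodule of `M_n(𝔽_q) ^ t` consists of the tuples whose rows lie in a
subspace `W` of `𝔽_q ^ (tn)` (`exists_eq_codeOf`), and `(𝔽_q ^ n) ^ k` corresponds to `dim W = k`.
Gaussian binomial coefficients then show that a tuple of rank `r` lies in a proportion
`∏ i < r, (q ^ k - q ^ i) / (q ^ (nt) - q ^ i)` of the codes (`ncard_codes_mem_mul`), which is roughly
`q ^ ((k - nt) * r)`. Whenever the reduction of `x ∈ O ^ t` is a nonzero element of the code, `x` is
primitive in the lattice of the code exactly if it is primitive in `O ^ t`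
(`IsOrderIn.smul_embed_mem_primitiveVectors_iff`). Hence the average is the proportion belonging to
`r = n` times the sum of `f (β • x)` over the primitive `x ∈ O ^ t`, up to an error coming from the
vectors whose reduction has rank `r < n` (`IsOrderIn.abs_weight_sub_le`).

*Low rank.* The columns of the reduction of such an `x` lie in an `r`-dimensional subspace of
`𝔽_q ^ n`, so the coordinates of `x` lie in a right ideal `J` of `O` of index `q ^ (n * (n - r))`. As
`A` is a division algebra, a nonzero `y ∈ J` satisfies `[O : J] ≤ [O : y O] = |det (z ↦ y z)|`, and the
determinant is at most a constant times `‖y‖ ^ (n ^ 2 * m)`. So the nonzero vectors of `J ^ t` are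
long (`IsOrderIn.exists_norm_bound`), and comparing a sum over separated points with an integral over
disjoint balls (`exists_packing_bound`) bounds the sum over `β • J ^ t`. Adding up over the subspaces,
rank `r` contributes `O(q ^ (-(n - r) * (k - r)))`, which is `O(1 / q)` since `n ≤ k`
(`IsOrderIn.exists_average_bound`).

*Main term.* A function that is Riemann integrable over every box is continuous almost everywhere
(`IsRiemannIntegrable.ae_continuousAt`), so dominated convergence, applied to step functions on the
cells of the dilated lattice, shows that the normalised sums over `β • O ^ t` tend to `V⁻¹ ∫ f` as
`β → 0` (`tendsto_lattice_sum`). Möbius inversion over the content of a lattice vector turns this into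
the limit `(ζ(d) V)⁻¹ ∫ f` for the primitive vectors (`tendsto_primitive_sum`). Finally, the
proportion belonging to `r = n` is asymptotic to `q ^ ((k - nt) * n) = β ^ d`
(`tendsto_codeDensity`), and `β → 0` because `k < nt`.
-/

noncomputable section

namespace CodeLift

/-! ### Riemann integrability and integrability -/

open BoxIntegral in
/-- If `g` is Riemann integrable over a box, the points of the box at which `g` oscillates by at
least `ε` form a null set. -/
theorem measure_oscillation_eq_zero {ι : Type*} [Fintype ι] {g : (ι → ℝ) → ℝ} {I : Box ι}
    (h : BoxIntegral.Integrable I IntegrationParams.Riemann g BoxAdditiveMap.volume)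
    {ε : ℝ} (hε : 0 < ε) :
    volume ({x | ∀ U ∈ 𝓝 x, ∃ y ∈ U, ∃ z ∈ U, ε ≤ g y - g z} ∩ (I : Set (ι → ℝ))) = 0 := by
  classical
  set D : Set (ι → ℝ) := {x | ∀ U ∈ 𝓝 x, ∃ y ∈ U, ∃ z ∈ U, ε ≤ g y - g z} with hD
  suffices H : ∀ η : ℝ, 0 < η → volume (D ∩ (I : Set (ι → ℝ))) ≤ ENNReal.ofReal η by
    refine le_antisymm (le_of_forall_pos_le_add fun η hη => ?_) bot_le
    rcases eq_or_ne η ⊤ with rfl | hη'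
    · simp
    have := H η.toReal (ENNReal.toReal_pos hη.ne' hη')
    rwa [ENNReal.ofReal_toReal hη', ← zero_add η] at this
  intro η hη
  set e : ℝ := ε * η / 2 with he
  have he0 : 0 < e := by positivity
  set c := I.distortion
  set R := h.convergenceR e c
  have hR : ∀ x, R x = R 0 := h.convergenceR_cond e c rfl
  -- A partition twice as fine as needed stays admissible when tags move within their boxes.
  obtain ⟨π, hπ, hπp⟩ := IntegrationParams.Riemann.exists_memBaseSet_isPartition I le_rfl
    (fun x => ⟨(R x : ℝ) / 2, half_pos (Set.mem_Ioi.1 (R x).2)⟩)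
  have retag : ∀ y : Box ι → ι → ℝ, (∀ J, y J ∈ Box.Icc I) → (∀ J ∈ π, y J ∈ Box.Icc J) →
      ∀ hy, IntegrationParams.Riemann.MemBaseSet I c R ⟨π.toPrepartition, y, hy⟩ := by
    intro y _ hyJ hy
    refine ⟨fun J hJ x hx => ?_, fun _ J hJ => hyJ J hJ, fun hf => by simp [IntegrationParams.Riemann] at hf,
      fun hf => by simp [IntegrationParams.Riemann] at hf⟩
    have h1 := hπ.1 J hJ hx
    have h2 := hπ.1 J hJ (hyJ J hJ)
    simp only [Metric.mem_closedBall] at h1 h2 ⊢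
    rw [hR] at h1 h2 ⊢
    calc dist x (y J) ≤ dist x (π.tag J) + dist (y J) (π.tag J) := dist_triangle_right _ _ _
      _ ≤ _ := by linarith
  let Bad : Box ι → Prop := fun J => ∃ y ∈ Box.Icc J, ∃ z ∈ Box.Icc J, ε ≤ g y - g z
  have hex : ∀ J, ∃ p : (ι → ℝ) × (ι → ℝ), p.1 ∈ Box.Icc I ∧ p.2 ∈ Box.Icc I ∧
      (J ∈ π → p.1 ∈ Box.Icc J ∧ p.2 ∈ Box.Icc J ∧ (if Bad J then ε else 0) ≤ g p.1 - g p.2) := by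
    intro J
    by_cases hJ : J ∈ π
    · have hJI : Box.Icc J ≤ Box.Icc I := Box.le_iff_Icc.1 (π.le_of_mem hJ)
      by_cases hb : Bad J
      · obtain ⟨y, hy, z, hz, hyz⟩ := hb
        exact ⟨(y, z), hJI hy, hJI hz, fun _ => ⟨hy, hz, by
          rw [if_pos ⟨y, hy, z, hz, hyz⟩]; exact hyz⟩⟩
      · exact ⟨(J.upper, J.upper), hJI J.upper_mem_Icc, hJI J.upper_mem_Icc, fun _ =>
          ⟨J.upper_mem_Icc, J.upper_mem_Icc, by simp [hb]⟩⟩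
    · exact ⟨(I.upper, I.upper), I.upper_mem_Icc, I.upper_mem_Icc, fun h => absurd h hJ⟩
  choose p hp1 hp2 hp using hex
  have hdist := h.dist_integralSum_le_of_memBaseSet he0 he0
    (retag (fun J => (p J).1) hp1 (fun J hJ => (hp J hJ).1) hp1)
    (retag (fun J => (p J).2) hp2 (fun J hJ => (hp J hJ).2.1) hp2) rfl
  have hsum : ∑ J ∈ π.boxes with Bad J, volume.real (J : Set (ι → ℝ)) ≤ η := by
    have h1 : ∑ J ∈ π.boxes, volume.real (J : Set (ι → ℝ)) * (g (p J).1 - g (p J).2) ≤ e + e := by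
      refine le_trans (le_trans (le_of_eq ?_) (le_abs_self _)) hdist
      simp only [integralSum, ← Finset.sum_sub_distrib]
      refine Finset.sum_congr rfl fun J _ => ?_
      rw [BoxAdditiveMap.volume_apply, BoxAdditiveMap.volume_apply, measureReal_def,
        Box.volume_apply', smul_eq_mul, smul_eq_mul, mul_sub]
    have h2 : (∑ J ∈ π.boxes with Bad J, volume.real (J : Set (ι → ℝ))) * ε ≤ e + e := by
      refine le_trans ?_ h1
      rw [Finset.sum_filter, Finset.sum_mul]
      refine Finset.sum_le_sum fun J hJ => ?_
      have := mul_le_mul_of_nonneg_left (hp J hJ).2.2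
        (measureReal_nonneg (μ := volume) (s := (J : Set (ι → ℝ))))
      refine le_trans (le_of_eq ?_) this
      split_ifs <;> simp
    have h3 : e + e = η * ε := by rw [he]; ring
    exact le_of_mul_le_mul_right (h2.trans_eq h3) hε
  have hcov : D ∩ (I : Set (ι → ℝ)) ⊆ (⋃ J ∈ π.boxes.filter Bad, (J : Set (ι → ℝ))) ∪
      ⋃ J ∈ π.boxes, ((J : Set (ι → ℝ)) \ Box.Ioo J) := by
    rintro x ⟨hxD, hxI⟩
    obtain ⟨J, hJ, hxJ⟩ := hπp x hxI
    by_cases hx : x ∈ Box.Ioo J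
    · left
      have hop : IsOpen (Box.Ioo J) := isOpen_set_pi Set.finite_univ fun i _ => isOpen_Ioo
      obtain ⟨y, hy, z, hz, hyz⟩ := hxD _ (hop.mem_nhds hx)
      refine Set.mem_biUnion (Finset.mem_filter.2 ⟨hJ, y, Box.Ioo_subset_Icc _ hy, z,
        Box.Ioo_subset_Icc _ hz, hyz⟩) hxJ
    · right
      exact Set.mem_biUnion (x := J) hJ ⟨hxJ, hx⟩
  refine (measure_mono hcov).trans ((measure_union_le _ _).trans ?_)
  have hnull : volume (⋃ J ∈ π.boxes, ((J : Set (ι → ℝ)) \ Box.Ioo J)) = 0 := by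
    refine (measure_biUnion_null_iff π.boxes.countable_toSet).2 ?_
    intro J _
    exact ae_le_set.1 ((Box.coe_ae_eq_Icc J).trans (Box.Ioo_ae_eq_Icc J).symm).le
  rw [hnull, add_zero]
  refine (measure_biUnion_finset_le _ _).trans ?_
  have : ∑ J ∈ π.boxes with Bad J, volume (J : Set (ι → ℝ)) =
      ENNReal.ofReal (∑ J ∈ π.boxes with Bad J, volume.real (J : Set (ι → ℝ))) := by
    rw [ENNReal.ofReal_sum_of_nonneg fun _ _ => measureReal_nonneg]
    refine Finset.sum_congr rfl fun J _ => ?_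
    rw [ofReal_measureReal (Box.measure_coe_lt_top J volume).ne]
  rw [this]
  exact ENNReal.ofReal_le_ofReal hsum

/-- Lebesgue's criterion, in the direction that is needed: a function that is Riemann integrable
over every box is continuous almost everywhere. -/
theorem IsRiemannIntegrable.ae_continuousAt {d : ℕ} {f : EuclideanSpace ℝ (Fin d) → ℝ}
    (hf : IsRiemannIntegrable f) : ∀ᵐ x, ContinuousAt f x := by
  set g : (Fin d → ℝ) → ℝ := fun x => f (WithLp.toLp 2 x) with hg
  have key : ∀ᵐ x : Fin d → ℝ, ContinuousAt g x := by
    let I : ℕ → BoxIntegral.Box (Fin d) := fun N =>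
      ⟨fun _ => -(N + 1 : ℝ), fun _ => N + 1, fun _ => by
        have : (0 : ℝ) ≤ N := N.cast_nonneg
        linarith⟩
    have h0 : ∀ N M : ℕ, ∀ᵐ x : Fin d → ℝ,
        ¬ (x ∈ {x | ∀ U ∈ 𝓝 x, ∃ y ∈ U, ∃ z ∈ U, (1 / (M + 1 : ℝ)) ≤ g y - g z} ∩
          (I N : Set (Fin d → ℝ))) := fun N M =>
      measure_eq_zero_iff_ae_notMem.1 (measure_oscillation_eq_zero (hf (I N)) (by positivity))
    filter_upwards [ae_all_iff.2 fun N => ae_all_iff.2 fun M => h0 N M] with x hx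
    obtain ⟨N, hN⟩ : ∃ N, x ∈ (I N : Set (Fin d → ℝ)) := by
      obtain ⟨N, hN⟩ := exists_nat_gt ‖x‖
      refine ⟨N, fun i => ?_⟩
      have h1 := (norm_le_pi_norm x i).trans hN.le
      rw [Real.norm_eq_abs, abs_le] at h1
      constructor <;> simp only [I] <;> linarith
    rw [Metric.continuousAt_iff']
    intro ε hε
    obtain ⟨M, hM⟩ := exists_nat_one_div_lt hε
    have h1 := hx N M
    simp only [Set.mem_inter_iff, hN, and_true, Set.mem_ofPred_eq] at h1
    push Not at h1
    obtain ⟨U, hU, hU'⟩ := h1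
    filter_upwards [hU] with y hy
    have hxU := mem_of_mem_nhds hU
    rw [Real.dist_eq, abs_lt]
    constructor <;> linarith [hU' x hxU y hy, hU' y hy x hxU]
  have hmp := (EuclideanSpace.volume_preserving_symm_measurableEquiv_toLp (Fin d))
  have := hmp.quasiMeasurePreserving.ae key
  filter_upwards [this] with x hx
  have h2 : f = g ∘ (WithLp.ofLp : EuclideanSpace ℝ (Fin d) → _) := by
    ext y; simp [hg]
  rw [h2]
  exact ContinuousAt.comp (f := (WithLp.ofLp : EuclideanSpace ℝ (Fin d) → (Fin d → ℝ))) hx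
    (PiLp.continuous_ofLp 2 _).continuousAt

/-- Semi-admissible functions are dominated by an integrable radial power, in the form used
throughout. -/
theorem IsSemiAdmissible.exists_bound {d : ℕ} {f : EuclideanSpace ℝ (Fin d) → ℝ}
    (hf : IsSemiAdmissible f) :
    ∃ b s : ℝ, 0 < b ∧ (d : ℝ) < s ∧ ∀ x, |f x| ≤ b * (1 + ‖x‖) ^ (-s) := by
  obtain ⟨b, δ, hb, hδ, h⟩ := hf.decay
  refine ⟨b, d + δ, hb, by linarith, fun x => ?_⟩
  rw [Real.rpow_neg (by positivity), ← div_eq_mul_inv]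
  exact h x

theorem aestronglyMeasurable_of_ae_continuousAt {X : Type*} [TopologicalSpace X]
    [MeasurableSpace X] [OpensMeasurableSpace X] [SecondCountableTopology X] {μ : Measure X}
    {f : X → ℝ} (hf : ∀ᵐ x ∂μ, ContinuousAt f x) : AEStronglyMeasurable f μ := by
  have hm : MeasurableSet {x | ContinuousAt f x} := (IsGδ.setOfPred_continuousAt f).measurableSet
  have h1 : AEStronglyMeasurable f (μ.restrict {x | ContinuousAt f x}) :=
    ContinuousOn.aestronglyMeasurable (fun x hx => ContinuousAt.continuousWithinAt hx) hm
  rwa [Measure.restrict_eq_self_of_ae_mem (s := {x | ContinuousAt f x}) hf] at h1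

theorem IsSemiAdmissible.integrable {d : ℕ} {f : EuclideanSpace ℝ (Fin d) → ℝ}
    (hf : IsSemiAdmissible f) : Integrable f := by
  obtain ⟨b, s, hb, hs, h⟩ := hf.exists_bound
  refine Integrable.mono' ((integrable_one_add_norm (r := s) (by simpa using hs)).const_mul b)
    (aestronglyMeasurable_of_ae_continuousAt hf.riemann.ae_continuousAt) (.of_forall h)

/-! ### Sums over lattices -/

section Packing

/-- If two points differ by at most `M`, their weights `(1 + ‖·‖) ^ (-s)` are comparable. -/
theorem rpow_neg_one_add_norm_le {E : Type*} [NormedAddCommGroup E] {s M : ℝ} (hs : 0 ≤ s) (hM : 0 ≤ M) {x y : E}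
    (h : ‖x - y‖ ≤ M) : (1 + ‖x‖) ^ (-s) ≤ (1 + M) ^ s * (1 + ‖y‖) ^ (-s) := by
  have hx : 0 < 1 + ‖x‖ := by positivity
  have hy : 0 < 1 + ‖y‖ := by positivity
  have h1 : 1 + ‖y‖ ≤ (1 + M) * (1 + ‖x‖) := by
    have : ‖y‖ ≤ ‖x‖ + ‖x - y‖ := by
      rw [norm_sub_rev]; exact norm_le_norm_add_norm_sub' y x
    nlinarith [norm_nonneg x]
  have h2 := Real.rpow_le_rpow hy.le h1 hs
  rw [Real.mul_rpow (by positivity) hx.le] at h2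
  rw [Real.rpow_neg hx.le, Real.rpow_neg hy.le, inv_le_iff_one_le_mul₀ (by positivity),
    mul_assoc, mul_comm ((1 + ‖y‖) ^ s)⁻¹, ← mul_assoc, ← div_eq_mul_inv, one_le_div (by positivity)]
  exact h2

/-- Packing bound. For points `T a` that are `ρ`-separated and of norm at least `ρ`, the sum of
`(1 + ‖T a‖) ^ (-s)` with `s > dim E` is at most a constant times `ρ ^ (-dim E)`: on the disjoint
balls of radius `ρ / 2` around the points the weight is comparable with its value at the centre. -/
theorem exists_packing_bound (E : Type*) [NormedAddCommGroup E] [NormedSpace ℝ E]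
    [FiniteDimensional ℝ E] [MeasurableSpace E] [BorelSpace E] (μ : Measure E)
    [μ.IsAddHaarMeasure] {s : ℝ} (hs : (Module.finrank ℝ E : ℝ) < s) :
    ∃ C : ℝ, 0 < C ∧ ∀ {α : Type*} (T : α → E) {ρ : ℝ}, 0 < ρ →
      (∀ a b, a ≠ b → ρ ≤ ‖T a - T b‖) → (∀ a, ρ ≤ ‖T a‖) →
      Summable (fun a => (1 + ‖T a‖) ^ (-s)) ∧
        ∑' a, (1 + ‖T a‖) ^ (-s) ≤ C * (ρ ^ Module.finrank ℝ E)⁻¹ := by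
  set n := Module.finrank ℝ E
  have hs0 : 0 < s := lt_of_le_of_lt (Nat.cast_nonneg _) hs
  have hint : Integrable (fun x : E => (1 + ‖x‖) ^ (-s)) μ := integrable_one_add_norm hs
  set J : ℝ := ∫ x, (1 + ‖x‖) ^ (-s) ∂μ
  have hJ : 0 ≤ J := integral_nonneg fun x => by positivity
  set v : ℝ := μ.real (Metric.ball (0 : E) (1 / 2))
  have hv : 0 < v := ENNReal.toReal_pos (Metric.measure_ball_pos μ _ (by norm_num)).ne'
    measure_ball_lt_top.ne
  refine ⟨(2 : ℝ) ^ s * (J + 1) / v, by positivity, fun {α} T ρ hρ hsep hmin => ?_⟩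
  have hball : ∀ x : E, μ.real (Metric.ball x (ρ / 2)) = ρ ^ n * v := by
    intro x
    rw [measureReal_def, div_eq_mul_one_div ρ 2, Measure.addHaar_ball_mul_of_pos μ x hρ, ENNReal.toReal_mul,
      ENNReal.toReal_ofReal (by positivity)]
    rfl
  have key : ∀ u : Finset α, ∑ a ∈ u, (1 + ‖T a‖) ^ (-s) ≤
      (2 : ℝ) ^ s * (J + 1) / v * (ρ ^ n)⁻¹ := by
    intro u
    have hdisj : ((u : Set α)).Pairwise
        (Function.onFun Disjoint fun a => Metric.ball (T a) (ρ / 2)) := by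
      intro a _ b _ hab
      refine Metric.ball_disjoint_ball ?_
      rw [dist_eq_norm, add_halves]
      exact hsep a b hab
    have h1 : ∑ a ∈ u, ∫ y in Metric.ball (T a) (ρ / 2), (1 + ‖y‖) ^ (-s) ∂μ ≤ J := by
      rw [← integral_biUnion_finset u (fun _ _ => measurableSet_ball) hdisj
        fun _ _ => hint.integrableOn]
      exact setIntegral_le_integral hint (.of_forall fun x => by positivity)
    have h2 : ∀ a, (1 + ‖T a‖) ^ (-s) * (ρ ^ n * v) ≤
        2 ^ s * ∫ y in Metric.ball (T a) (ρ / 2), (1 + ‖y‖) ^ (-s) ∂μ := by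
      intro a
      rw [← integral_const_mul, ← hball (T a), mul_comm, ← smul_eq_mul, ← setIntegral_const]
      refine setIntegral_mono_on (integrableOn_const measure_ball_lt_top.ne)
        (hint.const_mul _).integrableOn measurableSet_ball fun y hy => ?_
      have hy' : ‖y - T a‖ < ρ / 2 := by rwa [← dist_eq_norm]
      have hy2 : 1 + ‖y‖ ≤ 2 * (1 + ‖T a‖) := by
        have := norm_le_norm_add_norm_sub' y (T a)
        have := hmin a
        linarith [norm_nonneg (T a)]
      have h3 := Real.rpow_le_rpow (by positivity) hy2 hs0.le
      rw [Real.mul_rpow (by positivity) (by positivity)] at h3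
      rw [Real.rpow_neg (by positivity), Real.rpow_neg (by positivity), ← div_eq_mul_inv,
        inv_eq_one_div, div_le_div_iff₀ (by positivity) (by positivity), one_mul]
      exact h3
    have h3 : (∑ a ∈ u, (1 + ‖T a‖) ^ (-s)) * (ρ ^ n * v) ≤ 2 ^ s * (J + 1) := by
      rw [Finset.sum_mul]
      refine (Finset.sum_le_sum fun a _ => h2 a).trans ?_
      rw [← Finset.mul_sum]
      gcongr
      linarith
    rw [div_mul_eq_mul_div, ← div_eq_mul_inv, div_div, le_div_iff₀ (by positivity)]
    exact h3
  have hnn : 0 ≤ fun a => (1 + ‖T a‖) ^ (-s) := fun a => by positivity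
  exact ⟨summable_of_sum_le hnn key, Real.tsum_le_of_sum_le hnn key⟩

/-- The packing bound for the sums of a semi-admissible function. -/
theorem IsSemiAdmissible.exists_packing_bound {d : ℕ} {f : EuclideanSpace ℝ (Fin d) → ℝ}
    (hf : IsSemiAdmissible f) :
    ∃ C : ℝ, 0 < C ∧ ∀ {α : Type*} (T : α → EuclideanSpace ℝ (Fin d)) {ρ : ℝ}, 0 < ρ →
      (∀ a b, a ≠ b → ρ ≤ ‖T a - T b‖) → (∀ a, ρ ≤ ‖T a‖) →
      Summable (fun a => |f (T a)|) ∧ ∑' a, |f (T a)| ≤ C * (ρ ^ d)⁻¹ := by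
  obtain ⟨b, s, hb, hs, hfb⟩ := hf.exists_bound
  obtain ⟨C, hC, hpack⟩ := CodeLift.exists_packing_bound (EuclideanSpace ℝ (Fin d)) volume
    (s := s) (by simpa using hs)
  rw [finrank_euclideanSpace_fin] at hpack
  refine ⟨b * C, by positivity, fun T ρ hρ hsep hmin => ?_⟩
  obtain ⟨h1, h2⟩ := hpack T hρ hsep hmin
  have hs1 : Summable fun a => |f (T a)| :=
    Summable.of_nonneg_of_le (fun _ => abs_nonneg _) (fun a => hfb _) (h1.mul_left b)
  refine ⟨hs1, (hs1.tsum_le_tsum (fun a => hfb _) (h1.mul_left b)).trans ?_⟩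
  rw [tsum_mul_left, mul_assoc]
  exact mul_le_mul_of_nonneg_left h2 hb.le

end Packing

section LatticeSums

variable {d : ℕ} {ι : Type*} [Fintype ι] (B : Module.Basis ι ℝ (EuclideanSpace ℝ (Fin d)))

theorem measurable_comp_floor (h : EuclideanSpace ℝ (Fin d) → ℝ) :
    Measurable fun z => h (ZSpan.floor B z) := by
  have hm : Measurable fun z : EuclideanSpace ℝ (Fin d) => fun i => ⌊B.repr z i⌋ := by
    refine measurable_pi_lambda _ fun i => Int.measurable_floor.comp ?_
    exact (LinearMap.continuous_of_finiteDimensional (B.coord i)).measurable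
  have : (fun z => h (ZSpan.floor B z)) =
      (fun c : ι → ℤ => h (∑ i, c i • B i)) ∘ fun z i => ⌊B.repr z i⌋ := by
    ext z
    simp [ZSpan.floor]
  rw [this]
  exact (measurable_of_countable _).comp hm

theorem norm_smul_floor_sub_le (β : ℝ) (hβ : 0 < β) (y : EuclideanSpace ℝ (Fin d)) :
    ‖β • (ZSpan.floor B (β⁻¹ • y) : EuclideanSpace ℝ (Fin d)) - y‖ ≤ β * ∑ i, ‖B i‖ := by
  have h1 : β • (ZSpan.floor B (β⁻¹ • y) : EuclideanSpace ℝ (Fin d)) - y =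
      -(β • ZSpan.fract B (β⁻¹ • y)) := by
    rw [ZSpan.fract_apply, smul_sub, smul_inv_smul₀ hβ.ne', neg_sub]
  rw [h1, norm_neg, norm_smul, Real.norm_of_nonneg hβ.le]
  exact mul_le_mul_of_nonneg_left (ZSpan.norm_fract_le B _) hβ.le

/-- A sum over the dilated lattice is an integral of the step function that takes on each cell the
value of `f` at the corner of that cell. -/
theorem integral_comp_smul_floor {f : EuclideanSpace ℝ (Fin d) → ℝ} {b s : ℝ} (hs : (d : ℝ) < s)
    (hb : 0 < b) (hf : ∀ x, |f x| ≤ b * (1 + ‖x‖) ^ (-s)) {β : ℝ} (hβ : 0 < β) :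
    ∫ y, f (β • (ZSpan.floor B (β⁻¹ • y) : EuclideanSpace ℝ (Fin d))) =
      β ^ d * (ZLattice.covolume (Submodule.span ℤ (Set.range B)) *
        ∑' x : Submodule.span ℤ (Set.range B), f (β • (x : EuclideanSpace ℝ (Fin d)))) := by
  have hs0 : 0 ≤ s := le_trans (Nat.cast_nonneg _) hs.le
  have hbase : Integrable (fun x : EuclideanSpace ℝ (Fin d) => (1 + ‖x‖) ^ (-s)) :=
    integrable_one_add_norm (by simpa using hs)
  set M := ∑ i, ‖B i‖
  have hM : 0 ≤ M := Finset.sum_nonneg fun _ _ => norm_nonneg _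
  have hint : Integrable fun z => f (β • (ZSpan.floor B z : EuclideanSpace ℝ (Fin d))) := by
    refine Integrable.mono' ((hbase.comp_smul hβ.ne').const_mul (b * (1 + β * M) ^ s))
      (measurable_comp_floor B fun x => f (β • x)).aestronglyMeasurable (.of_forall fun z => ?_)
    refine (hf _).trans ?_
    rw [mul_assoc]
    refine mul_le_mul_of_nonneg_left (rpow_neg_one_add_norm_le hs0 (by positivity) ?_) hb.le
    simpa [hβ.ne'] using norm_smul_floor_sub_le B β hβ (β • z)
  have h1 := Measure.integral_comp_inv_smul (volume : Measure (EuclideanSpace ℝ (Fin d)))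
    (fun z => f (β • (ZSpan.floor B z : EuclideanSpace ℝ (Fin d)))) β
  rw [h1, finrank_euclideanSpace_fin, abs_of_pos (by positivity), smul_eq_mul]
  congr 1
  have hF := ZSpan.isAddFundamentalDomain B (volume : Measure (EuclideanSpace ℝ (Fin d)))
  have : MeasurableConstVAdd (Submodule.span ℤ (Set.range B)) (EuclideanSpace ℝ (Fin d)) :=
    (inferInstance : MeasurableConstVAdd (Submodule.span ℤ (Set.range B)).toAddSubgroup _)
  have : VAddInvariantMeasure (Submodule.span ℤ (Set.range B)) (EuclideanSpace ℝ (Fin d)) volume :=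
    (inferInstance : VAddInvariantMeasure (Submodule.span ℤ (Set.range B)).toAddSubgroup _ volume)
  have : Countable (Submodule.span ℤ (Set.range B)) := inferInstance
  rw [hF.integral_eq_tsum'' _ hint, ZLattice.covolume_eq_measure_fundamentalDomain _ _ hF,
    ← tsum_mul_left]
  refine tsum_congr fun g => ?_
  rw [← smul_eq_mul, ← setIntegral_const]
  refine setIntegral_congr_fun (ZSpan.fundamentalDomain_measurableSet B) fun z hz => ?_
  have : (ZSpan.floor B (g +ᵥ z) : EuclideanSpace ℝ (Fin d)) = g := by
    have h2 : ZSpan.fract B (g +ᵥ z) = z := by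
      rw [Submodule.vadd_def, vadd_eq_add, ZSpan.fract_zSpan_add B z g.2]
      exact (ZSpan.fract_eq_self).2 hz
    rw [ZSpan.fract_apply, Submodule.vadd_def, vadd_eq_add, add_sub_right_comm] at h2
    have h3 : (g : EuclideanSpace ℝ (Fin d)) - (ZSpan.floor B (g +ᵥ z) : EuclideanSpace ℝ (Fin d)) = 0 := by
      simpa [Submodule.vadd_def] using h2
    exact (sub_eq_zero.1 h3).symm
  simp only [this]

/-- The normalised sums of a semi-admissible function over the dilates of a lattice converge to the
integral divided by the covolume. -/
theorem tendsto_lattice_sum {f : EuclideanSpace ℝ (Fin d) → ℝ} (hf : IsSemiAdmissible f) :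
    Tendsto (fun β : ℝ => β ^ d *
        ∑' x : Submodule.span ℤ (Set.range B), f (β • (x : EuclideanSpace ℝ (Fin d))))
      (𝓝[>] 0)
      (𝓝 ((ZLattice.covolume (Submodule.span ℤ (Set.range B)))⁻¹ * ∫ x, f x)) := by
  obtain ⟨b, s, hb, hs, h⟩ := hf.exists_bound
  have hs0 : 0 ≤ s := le_trans (Nat.cast_nonneg _) hs.le
  have hbase : Integrable (fun x : EuclideanSpace ℝ (Fin d) => (1 + ‖x‖) ^ (-s)) :=
    integrable_one_add_norm (by simpa using hs)
  set M := ∑ i, ‖B i‖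
  have hM : 0 ≤ M := Finset.sum_nonneg fun _ _ => norm_nonneg _
  have hV := ZLattice.covolume_pos (Submodule.span ℤ (Set.range B)) volume
  have hpos : ∀ᶠ β : ℝ in 𝓝[>] 0, 0 < β := eventually_mem_nhdsWithin
  have hone : ∀ᶠ β : ℝ in 𝓝[>] 0, β < 1 := (eventually_lt_nhds one_pos).filter_mono inf_le_left
  have main : Tendsto
      (fun β : ℝ => ∫ y, f (β • (ZSpan.floor B (β⁻¹ • y) : EuclideanSpace ℝ (Fin d))))
      (𝓝[>] 0) (𝓝 (∫ x, f x)) := by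
    refine tendsto_integral_filter_of_dominated_convergence
      (fun y => b * ((1 + M) ^ s * (1 + ‖y‖) ^ (-s))) ?_ ?_ ((hbase.const_mul _).const_mul _) ?_
    · refine .of_forall fun β => Measurable.aestronglyMeasurable ?_
      exact (measurable_comp_floor B fun x => f (β • x)).comp (measurable_const_smul β⁻¹)
    · filter_upwards [hpos, hone] with β hβ hβ1
      refine .of_forall fun y => (h _).trans (mul_le_mul_of_nonneg_left
        (rpow_neg_one_add_norm_le hs0 hM ((norm_smul_floor_sub_le B β hβ y).trans ?_)) hb.le)
      exact mul_le_of_le_one_left hM hβ1.le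
    · filter_upwards [hf.riemann.ae_continuousAt] with y hy
      refine hy.tendsto.comp ?_
      rw [tendsto_iff_norm_sub_tendsto_zero]
      have h0 : Tendsto (fun β : ℝ => β * M) (𝓝[>] 0) (𝓝 0) := by
        have : Tendsto (fun β : ℝ => β * M) (𝓝 0) (𝓝 (0 * M)) := tendsto_id.mul_const M
        rw [zero_mul] at this
        exact this.mono_left inf_le_left
      refine tendsto_of_tendsto_of_tendsto_of_le_of_le' tendsto_const_nhds h0
        (.of_forall fun _ => norm_nonneg _) ?_
      filter_upwards [hpos] with β hβ using norm_smul_floor_sub_le B β hβ y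
  refine (main.const_mul _).congr' ?_
  filter_upwards [hpos] with β hβ
  rw [integral_comp_smul_floor B hs hb h hβ]
  field_simp

end LatticeSums

/-! ### Möbius inversion and primitive vectors -/

section Content

variable {ι G : Type*} [Fintype ι] [AddCommGroup G] (b : Module.Basis ι ℤ G)

/-- The content of an element of a free abelian group: the greatest common divisor of its
coordinates, with content `0` for the zero element. -/
def content (x : G) : ℕ := Finset.univ.gcd fun i => (b.repr x i).natAbs

theorem dvd_content_iff {n : ℕ} {x : G} : n ∣ content b x ↔ ∃ y, x = n • y := by
  rw [content, Finset.dvd_gcd_iff]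
  constructor
  · intro h
    choose c hc using fun i => Int.natCast_dvd.2 (h i (Finset.mem_univ i))
    refine ⟨∑ i, c i • b i, b.repr.injective (Finsupp.ext fun i => ?_)⟩
    rw [map_nsmul, Finsupp.smul_apply, Module.Basis.repr_sum_self, hc, nsmul_eq_mul]
  · rintro ⟨y, rfl⟩ i _
    rw [map_nsmul]
    simp [Int.natAbs_mul]

theorem content_eq_zero_iff {x : G} : content b x = 0 ↔ x = 0 := by
  rw [← zero_dvd_iff, dvd_content_iff]
  simp

/-- **Möbius inversion** over a free abelian group: the sum over the elements of content one is an
alternating sum of the sums over the multiples `i • G`. -/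
theorem tsum_content_eq_one {h : G → ℝ} (h0 : h 0 = 0)
    (hs : ∀ i : ℕ, Summable fun x => |h (i • x)|)
    (hs' : Summable fun i : ℕ => ∑' x, |h (i • x)|) :
    ∑' x, (if content b x = 1 then h x else 0) =
      ∑' i : ℕ, (ArithmeticFunction.moebius i : ℝ) * ∑' x, h (i • x) := by
  classical
  let g : (G → ℝ) → ℕ → G → ℝ := fun k i x => if i ∣ content b x then k x else 0
  have hinj : ∀ i : ℕ, i ≠ 0 → Function.Injective fun x : G => i • x := by
    intro i hi x y hxy
    have : IsAddTorsionFree G := by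
      exact Function.Injective.isAddTorsionFree b.repr.toAddEquiv.toAddMonoidHom b.repr.injective
    exact nsmul_right_injective hi hxy
  have hrange : ∀ (k : G → ℝ) (i : ℕ), Function.support (g k i) ⊆ Set.range fun x : G => i • x := by
    intro k i x hx
    have : i ∣ content b x := by
      by_contra hn
      exact hx (if_neg hn)
    obtain ⟨y, hy⟩ := (dvd_content_iff b).1 this
    exact ⟨y, hy.symm⟩
  have hg : ∀ (k : G → ℝ) (i : ℕ) (x : G), g k i (i • x) = k (i • x) := fun k i x =>
    if_pos ((dvd_content_iff b).2 ⟨x, rfl⟩)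
  have hgz : ∀ k : G → ℝ, k 0 = 0 → g k 0 = 0 := by
    intro k hk
    funext x
    by_cases hx : x = 0
    · simp [g, hx, hk]
    · simp [g, content_eq_zero_iff, hx]
  have habs : |h 0| = 0 := by rw [h0, abs_zero]
  -- The sum over `i • G` as a sum over `G` with a divisibility condition.
  have ht : ∀ (k : G → ℝ), k 0 = 0 → ∀ i : ℕ, ∑' x, g k i x = ∑' x, k (i • x) := by
    intro k hk i
    rcases eq_or_ne i 0 with rfl | hi
    · rw [hgz k hk]; simp [hk]
    · rw [← (hinj i hi).tsum_eq (hrange k i)]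
      simp only [hg]
  have hsum : ∀ i : ℕ, Summable (g (fun x => |h x|) i) := by
    intro i
    rcases eq_or_ne i 0 with rfl | hi
    · rw [hgz _ habs]; exact summable_zero
    · refine ((hinj i hi).summable_iff fun x hx => ?_).1 ?_
      · by_contra hne
        exact hx (hrange (fun x => |h x|) i hne)
      · simpa only [Function.comp_def, hg] using hs i
  have hF : Summable fun p : ℕ × G =>
      (ArithmeticFunction.moebius p.1 : ℝ) * g h p.1 p.2 := by
    refine Summable.of_norm_bounded (g := fun p : ℕ × G => g (fun x => |h x|) p.1 p.2) ?_ ?_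
    · rw [summable_prod_of_nonneg]
      · exact ⟨hsum, by simpa only [ht (fun x => |h x|) habs] using hs'⟩
      · intro p
        simp only [g, Pi.zero_apply]
        split_ifs <;> positivity
    · rintro ⟨i, x⟩
      have hμ : |(ArithmeticFunction.moebius i : ℝ)| ≤ 1 := by
        exact_mod_cast ArithmeticFunction.abs_moebius_le_one
      simp only [g, norm_mul, Real.norm_eq_abs]
      split_ifs
      · exact mul_le_of_le_one_left (abs_nonneg _) hμ
      · simp
  calc ∑' x, (if content b x = 1 then h x else 0)
      = ∑' x, ∑' i : ℕ, (ArithmeticFunction.moebius i : ℝ) * g h i x := by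
        refine tsum_congr fun x => ?_
        by_cases hx : x = 0
        · simp [hx, h0, g]
        have hc : content b x ≠ 0 := mt (content_eq_zero_iff b).1 hx
        rw [tsum_eq_sum (s := (content b x).divisors)]
        · have h1 : ∀ i ∈ (content b x).divisors,
              (ArithmeticFunction.moebius i : ℝ) * g h i x =
                (ArithmeticFunction.moebius i : ℝ) * h x := by
            intro i hi
            simp [g, Nat.dvd_of_mem_divisors hi]
          rw [Finset.sum_congr rfl h1, ← Finset.sum_mul, ← Int.cast_sum,
            ← ArithmeticFunction.coe_mul_zeta_apply, ArithmeticFunction.moebius_mul_coe_zeta,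
            ArithmeticFunction.one_apply]
          split_ifs <;> simp
        · intro i hi
          have : ¬ i ∣ content b x := fun hd => hi (Nat.mem_divisors.2 ⟨hd, hc⟩)
          simp [g, this]
    _ = ∑' i : ℕ, ∑' x, (ArithmeticFunction.moebius i : ℝ) * g h i x :=
        (Summable.tsum_comm (f := fun (i : ℕ) (x : G) =>
          (ArithmeticFunction.moebius i : ℝ) * g h i x) hF)
    _ = _ := by
        refine tsum_congr fun i => ?_
        rw [tsum_mul_left, ht h h0]

end Content

/-- The Dirichlet series of the Möbius function at an integer `d > 1` is `1 / ζ(d)`. -/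
theorem tsum_moebius_div_pow {d : ℕ} (hd : 1 < d) :
    ∑' i : ℕ, (ArithmeticFunction.moebius i : ℝ) * ((i : ℝ) ^ d)⁻¹ =
      ((riemannZeta (d : ℂ)).re)⁻¹ := by
  have hre : 1 < ((d : ℂ)).re := by simpa using hd
  have h1 := ArithmeticFunction.LSeries_zeta_mul_Lseries_moebius hre
  rw [ArithmeticFunction.LSeries_zeta_eq_riemannZeta hre] at h1
  have h2 : LSeries (fun n => ((ArithmeticFunction.moebius n : ℤ) : ℂ)) (d : ℂ) =
      ((∑' i : ℕ, (ArithmeticFunction.moebius i : ℝ) * ((i : ℝ) ^ d)⁻¹ : ℝ) : ℂ) := by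
    rw [LSeries, Complex.ofReal_tsum]
    refine tsum_congr fun i => ?_
    rcases eq_or_ne i 0 with rfl | hi
    · simp
    · rw [LSeries.term_of_ne_zero hi]
      push_cast
      rw [Complex.cpow_natCast, div_eq_mul_inv]
  rw [h2] at h1
  have h3 := congrArg Complex.re h1
  rw [Complex.re_mul_ofReal, Complex.one_re] at h3
  exact eq_inv_of_mul_eq_one_right h3

section Primitive

variable {d : ℕ} {ι : Type*} [Fintype ι] (B : Module.Basis ι ℝ (EuclideanSpace ℝ (Fin d)))

/-- A vector of the lattice is primitive if and only if its coordinates are coprime. -/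
theorem mem_primitiveVectors_iff_content (x : Submodule.span ℤ (Set.range B)) :
    (x : EuclideanSpace ℝ (Fin d)) ∈ primitiveVectors (Submodule.span ℤ (Set.range B)) ↔
      content (B.restrictScalars ℤ) x = 1 := by
  set b := B.restrictScalars ℤ
  have hrepr : ∀ (y : Submodule.span ℤ (Set.range B)) (i : ι),
      B.repr (y : EuclideanSpace ℝ (Fin d)) i = ((b.repr y i : ℤ) : ℝ) := fun y i => by
    simpa using (B.restrictScalars_repr_apply ℤ y i).symm
  constructor
  · rintro ⟨-, hx0, hmin⟩
    have hc0 : content b x ≠ 0 := fun h => hx0 (by rw [(content_eq_zero_iff b).1 h]; rfl)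
    obtain ⟨y, hy⟩ := (dvd_content_iff b).1 (dvd_refl (content b x))
    have hxy : (x : EuclideanSpace ℝ (Fin d)) = (content b x : ℝ) • (y : EuclideanSpace ℝ (Fin d)) := by
      conv_lhs => rw [hy]
      simp [Nat.cast_smul_eq_nsmul]
    have hcR : (content b x : ℝ) ≠ 0 := Nat.cast_ne_zero.2 hc0
    have hy0 : (y : EuclideanSpace ℝ (Fin d)) ≠ 0 := by
      intro h
      rw [h, smul_zero] at hxy
      exact hx0 hxy
    have h1 := hmin y y.2 hy0 (Submodule.mem_span_singleton.2
      ⟨(content b x : ℝ)⁻¹, by rw [hxy, inv_smul_smul₀ hcR]⟩)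
    rw [hxy, norm_smul, Real.norm_natCast] at h1
    have h2 : (content b x : ℝ) ≤ 1 := by
      by_contra hlt
      push Not at hlt
      have := norm_pos_iff.2 hy0
      nlinarith
    have h3 : content b x ≤ 1 := by exact_mod_cast h2
    omega
  · intro hc
    have hx0 : x ≠ 0 := fun h => by
      rw [(content_eq_zero_iff b).2 h] at hc
      exact zero_ne_one hc
    have hx0' : (x : EuclideanSpace ℝ (Fin d)) ≠ 0 := fun h => hx0 (Subtype.ext h)
    refine ⟨x.2, hx0', fun y hyL hy0 hy => ?_⟩
    obtain ⟨r, rfl⟩ := Submodule.mem_span_singleton.1 hy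
    -- The ratio of two vectors on a line is rational; its denominator divides the content.
    have hcoord : ∀ i, ((b.repr ⟨_, hyL⟩ i : ℤ) : ℝ) = r * (b.repr x i : ℤ) := by
      intro i
      rw [← hrepr, ← hrepr]
      simp
    obtain ⟨i, hi⟩ : ∃ i, b.repr x i ≠ 0 := by
      by_contra hall
      push Not at hall
      exact hx0 (b.repr.map_eq_zero_iff.1 (Finsupp.ext hall))
    set ρ : ℚ := (b.repr ⟨_, hyL⟩ i : ℚ) / (b.repr x i : ℚ)
    have hρ : (ρ : ℝ) = r := by
      have : ((b.repr x i : ℤ) : ℝ) ≠ 0 := Int.cast_ne_zero.2 hi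
      simp only [ρ]
      push_cast
      rw [hcoord i]
      field_simp
    have hden : ρ.den ∣ content b x := by
      refine (dvd_content_iff b).2 ?_
      have hdvd : ∀ j, (ρ.den : ℤ) ∣ b.repr x j := by
        intro j
        have h1 : (ρ.den : ℤ) * b.repr ⟨_, hyL⟩ j = ρ.num * b.repr x j := by
          have h2 : ((ρ.den : ℤ) : ℝ) * (b.repr ⟨_, hyL⟩ j : ℤ) = (ρ.num : ℤ) * (b.repr x j : ℤ) := by
            rw [hcoord j, ← hρ, ← mul_assoc]
            congr 1
            exact_mod_cast Rat.den_mul_eq_num ρ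
          exact_mod_cast h2
        have hcop : IsCoprime (ρ.den : ℤ) ρ.num := by
          rw [Int.isCoprime_iff_nat_coprime]
          simpa using ρ.reduced.symm
        exact hcop.dvd_of_dvd_mul_left ⟨_, h1.symm⟩
      refine (dvd_content_iff b).1 ?_
      rw [content, Finset.dvd_gcd_iff]
      exact fun j _ => Int.natCast_dvd.1 (hdvd j)
    rw [hc, Nat.dvd_one] at hden
    have hρi : (ρ.num : ℝ) = r := by
      rw [← hρ]
      have := Rat.coe_int_num_of_den_eq_one hden
      exact_mod_cast this
    have hnum : ρ.num ≠ 0 := by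
      intro h
      rw [h, Int.cast_zero] at hρi
      exact hy0 (by rw [← hρi, zero_smul])
    rw [← hρi, norm_smul, Real.norm_eq_abs]
    refine le_mul_of_one_le_left (norm_nonneg _) ?_
    exact_mod_cast Int.one_le_abs hnum

/-- The lattice spanned by a basis is uniformly discrete. -/
theorem exists_pos_le_norm_of_mem_span :
    ∃ ρ : ℝ, 0 < ρ ∧ ∀ x ∈ Submodule.span ℤ (Set.range B), x ≠ 0 → ρ ≤ ‖x‖ := by
  have hd : DiscreteTopology (Submodule.span ℤ (Set.range B)) := inferInstance
  obtain ⟨ε, hε, h⟩ := Metric.isOpen_iff.1 (discreteTopology_iff_isOpen_singleton.1 hd 0) 0 rfl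
  refine ⟨ε, hε, fun x hx hx0 => ?_⟩
  by_contra hlt
  push Not at hlt
  have : (⟨x, hx⟩ : Submodule.span ℤ (Set.range B)) ∈ Metric.ball 0 ε := by
    rw [Metric.mem_ball, dist_zero_right]
    exact hlt
  exact hx0 (congrArg Subtype.val (h this))

end Primitive

section Punctured

variable {d : ℕ} {ι : Type*} (B : Module.Basis ι ℝ (EuclideanSpace ℝ (Fin d)))

/-- The summand of a dilated lattice sum, with the term of the zero vector removed. -/
def puncturedTerm (f : EuclideanSpace ℝ (Fin d) → ℝ) (γ : ℝ)
    (x : Submodule.span ℤ (Set.range B)) : ℝ :=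
  open Classical in if x = 0 then 0 else f (γ • (x : EuclideanSpace ℝ (Fin d)))

theorem puncturedTerm_zero (f : EuclideanSpace ℝ (Fin d) → ℝ) (γ : ℝ) :
    puncturedTerm B f γ 0 = 0 := if_pos rfl

theorem puncturedTerm_of_ne (f : EuclideanSpace ℝ (Fin d) → ℝ) (γ : ℝ)
    {x : Submodule.span ℤ (Set.range B)} (hx : x ≠ 0) :
    puncturedTerm B f γ x = f (γ • (x : EuclideanSpace ℝ (Fin d))) := if_neg hx

theorem puncturedTerm_nsmul (f : EuclideanSpace ℝ (Fin d) → ℝ) (γ : ℝ) {i : ℕ} (hi : i ≠ 0)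
    (x : Submodule.span ℤ (Set.range B)) :
    puncturedTerm B f γ (i • x) = puncturedTerm B f (i * γ) x := by
  have hcoe : ((i • x : Submodule.span ℤ (Set.range B)) : EuclideanSpace ℝ (Fin d)) =
      (i : ℝ) • (x : EuclideanSpace ℝ (Fin d)) := by
    rw [Nat.cast_smul_eq_nsmul]
    rfl
  by_cases hx : x = 0
  · rw [hx, smul_zero, puncturedTerm_zero, puncturedTerm_zero]
  · have h1 : i • x ≠ 0 := fun h => by
      refine hx (Subtype.ext ?_)
      have h2 : (i : ℝ) • (x : EuclideanSpace ℝ (Fin d)) = 0 := by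
        rw [← hcoe, h, Submodule.coe_zero]
      exact (smul_eq_zero.1 h2).resolve_left (Nat.cast_ne_zero.2 hi)
    rw [puncturedTerm_of_ne B f γ h1, puncturedTerm_of_ne B f _ hx, mul_comm, mul_smul,
      hcoe]

variable [Fintype ι]

/-- The punctured sums over all dilates `γ • L` are `O(γ ^ (-d))`, uniformly in `γ > 0`. -/
theorem exists_puncturedTerm_bound {f : EuclideanSpace ℝ (Fin d) → ℝ} (hf : IsSemiAdmissible f) :
    ∃ C : ℝ, 0 < C ∧ ∀ γ : ℝ, 0 < γ → (Summable fun x => |puncturedTerm B f γ x|) ∧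
      ∑' x, |puncturedTerm B f γ x| ≤ C * (γ ^ d)⁻¹ := by
  obtain ⟨C, hC, hpack⟩ := hf.exists_packing_bound
  obtain ⟨ρ, hρ, hmin⟩ := exists_pos_le_norm_of_mem_span B
  refine ⟨C * (ρ ^ d)⁻¹, by positivity, fun γ hγ => ?_⟩
  obtain ⟨h1, h2⟩ := hpack (fun x : ({0}ᶜ : Set (Submodule.span ℤ (Set.range B))) =>
      γ • ((x : Submodule.span ℤ (Set.range B)) : EuclideanSpace ℝ (Fin d)))
    (mul_pos hγ hρ) (fun x y hxy => by
      rw [← smul_sub, norm_smul, Real.norm_of_nonneg hγ.le]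
      refine mul_le_mul_of_nonneg_left (hmin _ (Submodule.sub_mem _ x.1.2 y.1.2) ?_) hγ.le
      exact sub_ne_zero.2 fun h => hxy (Subtype.ext (Subtype.ext h))) (fun x => by
      rw [norm_smul, Real.norm_of_nonneg hγ.le]
      exact mul_le_mul_of_nonneg_left (hmin _ x.1.2 fun h => x.2 (Subtype.ext h)) hγ.le)
  have hsupp : (fun x => |puncturedTerm B f γ x|) =
      Set.indicator ({0}ᶜ : Set (Submodule.span ℤ (Set.range B)))
        fun x => |f (γ • (x : EuclideanSpace ℝ (Fin d)))| := by
    funext x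
    by_cases hx : x = 0
    · rw [hx, puncturedTerm_zero, Set.indicator_of_notMem (by simp), abs_zero]
    · rw [puncturedTerm_of_ne B f γ hx, Set.indicator_of_mem (by simpa using hx)]
  rw [hsupp]
  refine ⟨summable_subtype_iff_indicator.1 h1, ?_⟩
  rw [← tsum_subtype]
  refine h2.trans_eq ?_
  rw [mul_pow, mul_inv]
  ring

/-- Removing the zero vector does not change the limit of the normalised lattice sums. -/
theorem tendsto_punctured_sum (hd : 0 < d) {f : EuclideanSpace ℝ (Fin d) → ℝ}
    (hf : IsSemiAdmissible f) :
    Tendsto (fun γ : ℝ => γ ^ d * ∑' x, puncturedTerm B f γ x) (𝓝[>] 0)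
      (𝓝 ((ZLattice.covolume (Submodule.span ℤ (Set.range B)))⁻¹ * ∫ x, f x)) := by
  obtain ⟨C, hC, hbound⟩ := exists_puncturedTerm_bound B hf
  have hpos : ∀ᶠ β : ℝ in 𝓝[>] 0, 0 < β := eventually_mem_nhdsWithin
  have h0 : Tendsto (fun γ : ℝ => γ ^ d * f 0) (𝓝[>] 0) (𝓝 0) := by
    have : Tendsto (fun γ : ℝ => γ ^ d * f 0) (𝓝 0) (𝓝 (0 ^ d * f 0)) :=
      (tendsto_id.pow d).mul_const _
    rw [zero_pow hd.ne', zero_mul] at this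
    exact this.mono_left inf_le_left
  have h1 := (tendsto_lattice_sum B hf).sub h0
  rw [sub_zero] at h1
  refine h1.congr' ?_
  filter_upwards [hpos] with γ hγ
  rw [← mul_sub]
  congr 1
  have hsF : Summable (puncturedTerm B f γ) := (hbound γ hγ).1.of_abs
  classical
  have h2 : (fun x : Submodule.span ℤ (Set.range B) => f (γ • (x : EuclideanSpace ℝ (Fin d)))) =
      fun x => puncturedTerm B f γ x +
        Pi.single (M := fun _ => ℝ) (0 : Submodule.span ℤ (Set.range B)) (f 0) x := by
    funext x
    by_cases hx : x = 0
    · subst hx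
      rw [puncturedTerm_zero, Pi.single_eq_same, zero_add, Submodule.coe_zero, smul_zero]
    · rw [puncturedTerm_of_ne B f γ hx, Pi.single_eq_of_ne hx, add_zero]
  rw [h2, hsF.tsum_add (hasSum_pi_single _ _).summable, tsum_pi_single, add_sub_cancel_right]

/-- The normalised sum over primitive vectors as a Möbius sum of punctured lattice sums. -/
theorem primitive_sum_eq (hd : 1 < d) {f : EuclideanSpace ℝ (Fin d) → ℝ}
    (hf : IsSemiAdmissible f) {β : ℝ} (hβ : 0 < β) :
    β ^ d * ∑' x, (primitiveVectors (Submodule.span ℤ (Set.range B))).indicator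
        (fun x => f (β • x)) (x : Submodule.span ℤ (Set.range B)) =
      ∑' i : ℕ, (ArithmeticFunction.moebius i : ℝ) * ((i : ℝ) ^ d)⁻¹ *
        ((i * β) ^ d * ∑' x, puncturedTerm B f (i * β) x) := by
  classical
  obtain ⟨C, hC, hbound⟩ := exists_puncturedTerm_bound B hf
  have h1 := tsum_content_eq_one (B.restrictScalars ℤ) (h := puncturedTerm B f β)
    (puncturedTerm_zero B f β) ?_ ?_
  · have h2 : ∀ x : Submodule.span ℤ (Set.range B),
        (primitiveVectors (Submodule.span ℤ (Set.range B))).indicator (fun x => f (β • x))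
          (x : EuclideanSpace ℝ (Fin d)) =
        if content (B.restrictScalars ℤ) x = 1 then puncturedTerm B f β x else 0 := by
      intro x
      rw [Set.indicator_apply, mem_primitiveVectors_iff_content]
      by_cases hx : x = 0
      · rw [hx, (content_eq_zero_iff _).2 rfl, if_neg zero_ne_one, if_neg zero_ne_one]
      · rw [puncturedTerm_of_ne B f β hx]
        split_ifs <;> rfl
    rw [tsum_congr h2, h1, ← tsum_mul_left]
    refine tsum_congr fun i => ?_
    rcases eq_or_ne i 0 with rfl | hi
    · simp
    · have hi' : (i : ℝ) ≠ 0 := Nat.cast_ne_zero.2 hi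
      simp only [puncturedTerm_nsmul B f β hi]
      rw [mul_pow]
      field_simp
  · intro i
    rcases eq_or_ne i 0 with rfl | hi
    · simp only [zero_smul, puncturedTerm_zero, abs_zero]
      exact summable_zero
    · simp only [puncturedTerm_nsmul B f β hi]
      exact (hbound _ (by positivity)).1
  · refine Summable.of_nonneg_of_le (fun i => tsum_nonneg fun _ => abs_nonneg _) (fun i => ?_)
      ((Real.summable_nat_pow_inv.2 hd).mul_left (C * (β ^ d)⁻¹))
    rcases eq_or_ne i 0 with rfl | hi
    · simp only [zero_smul, puncturedTerm_zero, abs_zero, tsum_zero]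
      positivity
    · simp only [puncturedTerm_nsmul B f β hi]
      refine (hbound _ (by positivity)).2.trans_eq ?_
      rw [mul_pow, mul_inv]
      ring

/-- The normalised sums of a semi-admissible function over the primitive vectors of the dilates of a
lattice converge to the integral divided by `ζ(d)` times the covolume. -/
theorem tendsto_primitive_sum (hd : 1 < d) {f : EuclideanSpace ℝ (Fin d) → ℝ}
    (hf : IsSemiAdmissible f) :
    Tendsto (fun β : ℝ => β ^ d *
        ∑' x, (primitiveVectors (Submodule.span ℤ (Set.range B))).indicator
          (fun x => f (β • x)) (x : Submodule.span ℤ (Set.range B)))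
      (𝓝[>] 0)
      (𝓝 (((riemannZeta (d : ℂ)).re * ZLattice.covolume (Submodule.span ℤ (Set.range B)))⁻¹ *
        ∫ x, f x)) := by
  obtain ⟨C, hC, hbound⟩ := exists_puncturedTerm_bound B hf
  have hpos : ∀ᶠ β : ℝ in 𝓝[>] 0, 0 < β := eventually_mem_nhdsWithin
  have hSb : ∀ γ : ℝ, 0 < γ → |γ ^ d * ∑' x, puncturedTerm B f γ x| ≤ C := by
    intro γ hγ
    obtain ⟨h1, h2⟩ := hbound γ hγ
    have h3 : |∑' x, puncturedTerm B f γ x| ≤ ∑' x, |puncturedTerm B f γ x| :=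
      norm_tsum_le_tsum_norm (f := puncturedTerm B f γ) h1
    have hγd : 0 < γ ^ d := by positivity
    rw [abs_mul, abs_of_pos hγd]
    calc γ ^ d * |∑' x, puncturedTerm B f γ x| ≤ γ ^ d * (C * (γ ^ d)⁻¹) :=
          mul_le_mul_of_nonneg_left (h3.trans h2) hγd.le
      _ = C := by field_simp
  have hlim := tendsto_tsum_of_dominated_convergence (𝓕 := 𝓝[>] (0 : ℝ))
    (f := fun (β : ℝ) (i : ℕ) => (ArithmeticFunction.moebius i : ℝ) *
      ((i : ℝ) ^ d)⁻¹ * ((i * β) ^ d * ∑' x, puncturedTerm B f (i * β) x))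
    (g := fun i => (ArithmeticFunction.moebius i : ℝ) * ((i : ℝ) ^ d)⁻¹ *
      ((ZLattice.covolume (Submodule.span ℤ (Set.range B)))⁻¹ * ∫ x, f x))
    (bound := fun i : ℕ => ((i : ℝ) ^ d)⁻¹ * C)
    ((Real.summable_nat_pow_inv.2 hd).mul_right C) (fun i => ?_) ?_
  · rw [tsum_mul_right, tsum_moebius_div_pow hd, ← mul_assoc, ← mul_inv] at hlim
    refine hlim.congr' ?_
    filter_upwards [hpos] with β hβ using (primitive_sum_eq B hd hf hβ).symm
  · rcases eq_or_ne i 0 with rfl | hi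
    · simp
    · refine Tendsto.const_mul _ ((tendsto_punctured_sum B (by omega) hf).comp
        (f := fun β : ℝ => (i : ℝ) * β) ?_)
      have h1 : Tendsto (fun β : ℝ => (i : ℝ) * β) (𝓝 0) (𝓝 (i * 0)) := tendsto_id.const_mul _
      rw [mul_zero] at h1
      refine tendsto_nhdsWithin_iff.2 ⟨h1.mono_left inf_le_left, ?_⟩
      filter_upwards [hpos] with β hβ
      exact Set.mem_Ioi.2 (by positivity)
  · filter_upwards [hpos] with β hβ
    intro i
    rcases eq_or_ne i 0 with rfl | hi
    · simp only [ArithmeticFunction.map_zero, Int.cast_zero, zero_mul, norm_zero]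
      positivity
    · have hμ : |(ArithmeticFunction.moebius i : ℝ)| ≤ 1 := by
        exact_mod_cast ArithmeticFunction.abs_moebius_le_one
      rw [Real.norm_eq_abs, abs_mul, abs_mul, abs_of_nonneg (by positivity : 0 ≤ ((i : ℝ) ^ d)⁻¹)]
      exact mul_le_mul (mul_le_of_le_one_left (by positivity) hμ) (hSb _ (by positivity))
        (abs_nonneg _) (by positivity)

end Punctured

/-! ### Counting codes -/

section Subspaces

variable {F V : Type*} [Field F] [Finite F] [AddCommGroup V] [Module F V] [Finite V]

variable (F) in
/-- `c(k, r) = ∏ i < r, (q ^ k - q ^ i)`, the number of linearly independent `r`-tuples in a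
`k`-dimensional space over a field with `q` elements, as a real number. -/
def frameCount (k r : ℕ) : ℝ := ∏ i ∈ Finset.range r, ((Nat.card F : ℝ) ^ k - (Nat.card F : ℝ) ^ i)

theorem one_lt_natCard : (1 : ℝ) < Nat.card F := by exact_mod_cast Finite.one_lt_card

variable (F) in
theorem frameCount_pos {k r : ℕ} (h : r ≤ k) : 0 < frameCount F k r := by
  refine Finset.prod_pos fun i hi => sub_pos.2 ?_
  exact pow_lt_pow_right₀ one_lt_natCard ((Finset.mem_range.1 hi).trans_le h)

theorem natCard_linearIndependent {k : ℕ} (hk : k ≤ Module.finrank F V) :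
    (Nat.card {s : Fin k → V // LinearIndependent F s} : ℝ) =
      frameCount F (Module.finrank F V) k := by
  have := Fintype.ofFinite F
  rw [card_linearIndependent hk, frameCount, Nat.cast_prod, ← Fin.prod_univ_eq_prod_range
    (fun i => (Nat.card F : ℝ) ^ Module.finrank F V - (Nat.card F : ℝ) ^ i)]
  refine Finset.prod_congr rfl fun i _ => ?_
  rw [Nat.cast_sub (Nat.pow_le_pow_right Fintype.card_pos (i.2.le.trans hk)),
    Nat.card_eq_fintype_card]
  push_cast
  rfl

omit [Finite F] in
theorem span_range_coe_eq {k : ℕ} {W : Submodule F V} (hW : Module.finrank F W = k)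
    {s : Fin k → W} (hs : LinearIndependent F s) :
    Submodule.span F (Set.range fun i => (s i : V)) = W := by
  refine Submodule.eq_of_le_of_finrank_eq (Submodule.span_le.2 ?_) ?_
  · rintro _ ⟨i, rfl⟩
    exact (s i).2
  · rw [hW]
    exact (finrank_span_eq_card (hs.map' W.subtype (Submodule.ker_subtype _))).trans
      (Fintype.card_fin k)

/-- A `k`-dimensional subspace with a linearly independent `k`-tuple in it is the same as a linearly
independent `k`-tuple: the subspace is its span. -/
def sigmaEquivLinearIndependent (k : ℕ) :
    (Σ W : {W : Submodule F V // Module.finrank F W = k},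
      {s : Fin k → W.1 // LinearIndependent F s}) ≃ {s : Fin k → V // LinearIndependent F s} :=
  Equiv.ofBijective
    (fun p => ⟨fun i => p.2.1 i, p.2.2.map' p.1.1.subtype (Submodule.ker_subtype _)⟩) <| by
    constructor
    · rintro ⟨⟨W, hW⟩, ⟨s, hs⟩⟩ ⟨⟨W', hW'⟩, ⟨s', hs'⟩⟩ h
      have h1 : (fun i => (s i : V)) = fun i => (s' i : V) := congrArg Subtype.val h
      have h2 : W = W' := by
        rw [← span_range_coe_eq hW hs, ← span_range_coe_eq hW' hs', h1]
      subst h2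
      have h3 : s = s' := funext fun i => Subtype.ext (congrFun h1 i)
      subst h3
      rfl
    · rintro ⟨s, hs⟩
      exact ⟨⟨⟨Submodule.span F (Set.range s), by
        rw [finrank_span_eq_card hs, Fintype.card_fin]⟩,
        ⟨fun i => ⟨s i, Submodule.subset_span ⟨i, rfl⟩⟩, linearIndependent_span hs⟩⟩, rfl⟩

/-- The number of `k`-dimensional subspaces is the Gaussian binomial coefficient. -/
theorem natCard_subspaces_mul {k : ℕ} (hk : k ≤ Module.finrank F V) :
    (Nat.card {W : Submodule F V // Module.finrank F W = k} : ℝ) * frameCount F k k =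
      frameCount F (Module.finrank F V) k := by
  classical
  have := Fintype.ofFinite {W : Submodule F V // Module.finrank F W = k}
  rw [← natCard_linearIndependent hk, ← Nat.card_congr (sigmaEquivLinearIndependent k),
    Nat.card_sigma, Nat.cast_sum]
  have : ∀ W : {W : Submodule F V // Module.finrank F W = k},
      (Nat.card {s : Fin k → W.1 // LinearIndependent F s} : ℝ) = frameCount F k k := by
    intro W
    rw [natCard_linearIndependent W.2.ge, W.2]
  simp [this, Nat.card_eq_fintype_card]

omit [Finite F] in
theorem finrank_comap_mkQ (U : Submodule F V) (W : Submodule F (V ⧸ U)) :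
    Module.finrank F (W.comap U.mkQ) = Module.finrank F W + Module.finrank F U := by
  have h := LinearMap.finrank_range_add_finrank_ker (U.mkQ.domRestrict (W.comap U.mkQ))
  rw [LinearMap.range_domRestrict, Submodule.map_comap_eq_of_surjective U.mkQ_surjective,
    LinearMap.ker_domRestrict, Submodule.ker_mkQ] at h
  have hle : U ≤ W.comap U.mkQ := Submodule.le_comap_mkQ U W
  rw [← h]
  congr 1
  exact (Submodule.comapSubtypeEquivOfLe hle).finrank_eq

omit [Finite F] in
/-- Subspaces containing `U` are subspaces of the quotient by `U`. -/
theorem natCard_superspaces (U : Submodule F V) {k : ℕ} (hk : Module.finrank F U ≤ k) :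
    Nat.card {W : Submodule F V // Module.finrank F W = k ∧ U ≤ W} =
      Nat.card {W : Submodule F (V ⧸ U) // Module.finrank F W = k - Module.finrank F U} := by
  symm
  refine Nat.card_congr (Equiv.ofBijective (fun W => ⟨W.1.comap U.mkQ, ?_, ?_⟩) ⟨?_, ?_⟩)
  · rw [finrank_comap_mkQ, W.2]; omega
  · exact Submodule.le_comap_mkQ U W.1
  · intro W W' h
    exact Subtype.ext (Submodule.comap_injective_of_surjective U.mkQ_surjective
      (congrArg Subtype.val h))
  · rintro ⟨W, hW, hU⟩
    have h1 : (W.map U.mkQ).comap U.mkQ = W := by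
      rw [Submodule.comap_map_mkQ, sup_eq_right.2 hU]
    refine ⟨⟨W.map U.mkQ, ?_⟩, Subtype.ext h1⟩
    have h2 := finrank_comap_mkQ U (W.map U.mkQ)
    rw [h1, hW] at h2
    omega

omit [Field F] [Finite F] in
theorem frameCount_add (N r m : ℕ) :
    frameCount F (N + r) (m + r) =
      frameCount F (N + r) r * (((Nat.card F : ℝ) ^ r) ^ m * frameCount F N m) := by
  rw [frameCount, add_comm m r, Finset.prod_range_add, frameCount, frameCount]
  congr 1
  rw [← Finset.card_range m, ← Finset.prod_const, Finset.card_range, ← Finset.prod_mul_distrib]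
  refine Finset.prod_congr rfl fun i _ => ?_
  rw [pow_add, pow_add]
  ring

/-- Among the `k`-dimensional subspaces, the proportion that contains a given `r`-dimensional one is
`∏ i < r, (q ^ k - q ^ i) / (q ^ N - q ^ i)`. -/
theorem natCard_superspaces_mul (U : Submodule F V) {k : ℕ} (hU : Module.finrank F U ≤ k)
    (hk : k ≤ Module.finrank F V) :
    (Nat.card {W : Submodule F V // Module.finrank F W = k ∧ U ≤ W} : ℝ) *
        frameCount F (Module.finrank F V) (Module.finrank F U) =
      Nat.card {W : Submodule F V // Module.finrank F W = k} *
        frameCount F k (Module.finrank F U) := by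
  rw [natCard_superspaces U hU]
  have hq := Submodule.finrank_quotient_add_finrank U
  have : Finite (V ⧸ U) := Quotient.finite _
  have h1 := natCard_subspaces_mul (F := F) (V := V ⧸ U) (k := k - Module.finrank F U) (by omega)
  have h2 := natCard_subspaces_mul (F := F) (V := V) hk
  obtain ⟨m, rfl⟩ := Nat.exists_eq_add_of_le' hU
  rw [Nat.add_sub_cancel] at h1 ⊢
  generalize (Nat.card {W : Submodule F (V ⧸ U) // Module.finrank F W = m} : ℝ) = A at *
  generalize (Nat.card {W : Submodule F V // Module.finrank F W = m + Module.finrank F U} : ℝ) = B at *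
  rw [← hq] at h2 ⊢
  rw [frameCount_add, frameCount_add, ← h1] at h2
  generalize Module.finrank F (V ⧸ U) = N at *
  generalize Module.finrank F U = r at *
  have e1 : ((Nat.card F : ℝ) ^ r) ^ m ≠ 0 := by
    have := one_lt_natCard (F := F)
    positivity
  have e2 := (frameCount_pos F (le_refl m)).ne'
  refine mul_right_cancel₀ (mul_ne_zero e1 e2) ?_
  linear_combination -h2

/-- There are at most `2 ^ r * q ^ (r * (n - r))` subspaces of dimension `r`. -/
theorem natCard_subspaces_le {r : ℕ} (hr : r ≤ Module.finrank F V) :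
    (Nat.card {W : Submodule F V // Module.finrank F W = r} : ℝ) * (Nat.card F : ℝ) ^ (r * r) ≤
      2 ^ r * (Nat.card F : ℝ) ^ (r * Module.finrank F V) := by
  have hq := one_lt_natCard (F := F)
  have hq2 : (2 : ℝ) ≤ Nat.card F := by exact_mod_cast Finite.one_lt_card
  set q : ℝ := (Nat.card F : ℝ)
  have h := natCard_subspaces_mul (F := F) (V := V) hr
  have h1 : frameCount F (Module.finrank F V) r ≤ q ^ (r * Module.finrank F V) := by
    rw [mul_comm, pow_mul, frameCount]
    refine (Finset.prod_le_prod (g := fun _ => q ^ Module.finrank F V) (fun i hi => ?_)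
      fun i hi => ?_).trans_eq (by simp)
    · exact sub_nonneg.2 (pow_le_pow_right₀ hq.le ((Finset.mem_range.1 hi).le.trans hr))
    · exact sub_le_self _ (by positivity)
  have h2 : q ^ (r * r) ≤ 2 ^ r * frameCount F r r := by
    rw [pow_mul, frameCount]
    have : (2 : ℝ) ^ r = ∏ i ∈ Finset.range r, 2 := by simp
    rw [this, ← Finset.prod_mul_distrib]
    refine le_trans (by simp) (Finset.prod_le_prod (f := fun _ => q ^ r) (fun i hi => by positivity)
      fun i hi => ?_)
    have h3 : 2 * q ^ i ≤ q ^ r := by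
      calc 2 * q ^ i ≤ q * q ^ i := by gcongr
        _ = q ^ (i + 1) := by ring
        _ ≤ q ^ r := pow_le_pow_right₀ hq.le (Finset.mem_range.1 hi)
    linarith
  calc (Nat.card {W : Submodule F V // Module.finrank F W = r} : ℝ) * q ^ (r * r)
      ≤ Nat.card {W : Submodule F V // Module.finrank F W = r} * (2 ^ r * frameCount F r r) := by
        gcongr
    _ = 2 ^ r * frameCount F (Module.finrank F V) r := by rw [← h]; ring
    _ ≤ _ := by gcongr

end Subspaces

section Codes

variable {F : Type*} [Field F] {n t : ℕ}

/-- A tuple of `t` square matrices of size `n`, written side by side as an `n × tn` matrix. -/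
def flatten (X : Fin t → Matrix (Fin n) (Fin n) F) : Matrix (Fin n) (Fin t × Fin n) F :=
  Matrix.of fun a p => X p.1 a p.2

omit [Field F] in
theorem flatten_apply (X : Fin t → Matrix (Fin n) (Fin n) F) (a : Fin n) (p : Fin t × Fin n) :
    flatten X a p = X p.1 a p.2 := rfl

theorem flatten_smul (M : Matrix (Fin n) (Fin n) F) (X : Fin t → Matrix (Fin n) (Fin n) F)
    (a : Fin n) : flatten (M • X) a = ∑ b, M a b • flatten X b := by
  ext p
  simp [flatten_apply, Matrix.mul_apply, Finset.sum_apply]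

/-- The code attached to a subspace `W` of `F ^ (tn)`: all tuples whose rows lie in `W`. -/
def codeOf (W : Submodule F (Fin t × Fin n → F)) :
    Submodule (Matrix (Fin n) (Fin n) F) (Fin t → Matrix (Fin n) (Fin n) F) where
  carrier := {X | ∀ a, flatten X a ∈ W}
  zero_mem' a := W.zero_mem
  add_mem' hX hY a := W.add_mem (hX a) (hY a)
  smul_mem' M X hX a := by
    rw [flatten_smul]
    exact W.sum_mem fun b _ => W.smul_mem _ (hX b)

theorem mem_codeOf {W : Submodule F (Fin t × Fin n → F)}
    {X : Fin t → Matrix (Fin n) (Fin n) F} : X ∈ codeOf W ↔ ∀ a, flatten X a ∈ W := Iff.rfl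

theorem mem_codeOf_iff_span_le {W : Submodule F (Fin t × Fin n → F)}
    {X : Fin t → Matrix (Fin n) (Fin n) F} :
    X ∈ codeOf W ↔ Submodule.span F (Set.range (flatten X).row) ≤ W := by
  rw [Submodule.span_le, Set.range_subset_iff]
  exact Iff.rfl

/-- The tuple whose `a`-th row is `w` and whose other rows vanish. -/
def singleRow (a : Fin n) (w : Fin t × Fin n → F) : Fin t → Matrix (Fin n) (Fin n) F :=
  fun j => Matrix.of fun a' i => if a' = a then w (j, i) else 0

theorem flatten_singleRow (a a' : Fin n) (w : Fin t × Fin n → F) :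
    flatten (singleRow a w) a' = if a' = a then w else 0 := by
  ext p
  simp only [flatten_apply, singleRow, Matrix.of_apply]
  split_ifs <;> rfl

omit [Field F] in
theorem flatten_injective : Function.Injective (flatten : (Fin t → Matrix (Fin n) (Fin n) F) → _) := by
  intro X Y h
  ext j a i
  exact congrFun (congrFun h a) (j, i)

theorem singleRow_flatten (a b : Fin n) (X : Fin t → Matrix (Fin n) (Fin n) F) :
    singleRow a (flatten X b) = Matrix.single a b (1 : F) • X := by
  refine flatten_injective ?_
  ext a' : 1
  rw [flatten_singleRow, flatten_smul]
  by_cases h : a' = a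
  · subst h
    rw [if_pos rfl, Finset.sum_eq_single b] <;> simp +contextual [eq_comm]
  · have h' : ¬ a = a' := fun h2 => h h2.symm
    simp [h, h']

theorem sum_singleRow (X : Fin t → Matrix (Fin n) (Fin n) F) :
    ∑ a, singleRow a (flatten X a) = X := by
  ext j a i
  simp [singleRow, Finset.sum_apply, Matrix.sum_apply, flatten_apply]

/-- Every submodule of `M_n(F) ^ t` is the code of a subspace: the elements of a submodule are
recovered from their rows through matrix units. -/
theorem exists_eq_codeOf
    (C : Submodule (Matrix (Fin n) (Fin n) F) (Fin t → Matrix (Fin n) (Fin n) F)) :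
    ∃ W : Submodule F (Fin t × Fin n → F), C = codeOf W := by
  let W : Submodule F (Fin t × Fin n → F) :=
    { carrier := {w | ∀ a, singleRow a w ∈ C}
      zero_mem' := fun a => by
        have : singleRow a (0 : Fin t × Fin n → F) = 0 := by
          ext j a' i; simp [singleRow]
        rw [this]; exact C.zero_mem
      add_mem' := fun {v w} hv hw a => by
        have : singleRow a (v + w) = singleRow a v + singleRow a w := by
          ext j a' i; simp only [singleRow, Matrix.of_apply, Pi.add_apply, Matrix.add_apply]
          split_ifs <;> simp
        rw [this]; exact C.add_mem (hv a) (hw a)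
      smul_mem' := fun c w hw a => by
        have : singleRow a (c • w) = Matrix.scalar (Fin n) c • singleRow a w := by
          ext j a' i; simp [singleRow]
        rw [this]; exact C.smul_mem _ (hw a) }
  refine ⟨W, le_antisymm (fun X hX a a' => ?_) fun X hX => ?_⟩
  · rw [singleRow_flatten]
    exact C.smul_mem _ hX
  · rw [← sum_singleRow X]
    exact C.sum_mem fun a _ => hX a a

/-- The code of a `k`-dimensional subspace is isomorphic to `(F ^ n) ^ k`, through the coordinates of
the rows in a basis. -/
theorem codeOf_mem_codes {k : ℕ} {W : Submodule F (Fin t × Fin n → F)}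
    (hW : Module.finrank F W = k) : codeOf W ∈ codes F n t k := by
  have b : Module.Basis (Fin k) F W := Module.finBasisOfFinrankEq F W hW
  let g : codeOf W →ₗ[Matrix (Fin n) (Fin n) F] (Fin k → Fin n → F) :=
    { toFun := fun X l a => b.repr ⟨flatten X.1 a, X.2 a⟩ l
      map_add' := fun X Y => by
        ext l a
        have : (⟨flatten (X + Y).1 a, (X + Y).2 a⟩ : W) =
          ⟨flatten X.1 a, X.2 a⟩ + ⟨flatten Y.1 a, Y.2 a⟩ := rfl
        simp only [this, map_add]
        rfl
      map_smul' := fun M X => by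
        ext l a
        have : (⟨flatten (M • X).1 a, (M • X).2 a⟩ : W) =
            ∑ c, M a c • ⟨flatten X.1 c, X.2 c⟩ := Subtype.ext ((flatten_smul M X.1 a).trans (by simp))
        simp only [this, map_sum, map_smul, Finsupp.coe_finsetSum, Finset.sum_apply,
          Finsupp.smul_apply, RingHom.id_apply, Pi.smul_apply, Matrix.smul_eq_mulVec,
          Matrix.mulVec, dotProduct, smul_eq_mul] }
  refine ⟨LinearEquiv.ofBijective g ⟨?_, ?_⟩⟩
  · intro X Y h
    refine Subtype.ext (flatten_injective (funext fun a => ?_))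
    have : (⟨flatten X.1 a, X.2 a⟩ : W) = ⟨flatten Y.1 a, Y.2 a⟩ :=
      b.repr.injective (Finsupp.ext fun l => congrFun (congrFun h l) a)
    exact congrArg Subtype.val this
  · intro v
    let w : Fin n → W := fun a => ∑ l, v l a • b l
    have hflat : ∀ a, flatten (fun j => Matrix.of fun a i => (w a : Fin t × Fin n → F) (j, i)) a =
        w a := fun a => rfl
    refine ⟨⟨fun j => Matrix.of fun a i => (w a : Fin t × Fin n → F) (j, i), fun a => ?_⟩, ?_⟩
    · rw [hflat]; exact (w a).2
    · ext l a
      change b.repr (w a) l = v l a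
      simp only [w]
      rw [b.repr_sum_self fun l => v l a]

variable [Finite F]

omit [Finite F] in
theorem natCard_codeOf (W : Submodule F (Fin t × Fin n → F)) :
    Nat.card (codeOf W) = Nat.card F ^ (Module.finrank F W * n) := by
  have e : codeOf W ≃ (Fin n → W) :=
    { toFun := fun X a => ⟨flatten X.1 a, X.2 a⟩
      invFun := fun w => ⟨fun j => Matrix.of fun a i => (w a : Fin t × Fin n → F) (j, i),
        fun a => (w a).2⟩
      left_inv := fun X => rfl
      right_inv := fun w => rfl }
  rw [Nat.card_congr e, Nat.card_fun, Module.natCard_eq_pow_finrank (K := F) (V := W),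
    Nat.card_eq_fintype_card (α := Fin n), Fintype.card_fin, pow_mul]

omit [Finite F] in
theorem natCard_of_mem_codes {k : ℕ}
    {C : Submodule (Matrix (Fin n) (Fin n) F) (Fin t → Matrix (Fin n) (Fin n) F)}
    (hC : C ∈ codes F n t k) : Nat.card C = Nat.card F ^ (k * n) := by
  obtain ⟨e⟩ := hC
  rw [Nat.card_congr e.toEquiv, Nat.card_fun, Nat.card_fun]
  simp only [Nat.card_eq_fintype_card (α := Fin _), Fintype.card_fin]
  rw [← pow_mul, mul_comm]

/-- The codes correspond to the `k`-dimensional subspaces of `F ^ (tn)`. -/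
theorem codes_eq_image (hn : 0 < n) (k : ℕ) :
    codes F n t k = codeOf '' {W | Module.finrank F W = k} := by
  ext C
  constructor
  · intro hC
    obtain ⟨W, rfl⟩ := exists_eq_codeOf C
    refine ⟨W, ?_, rfl⟩
    have h1 := natCard_of_mem_codes hC
    rw [natCard_codeOf] at h1
    exact Nat.eq_of_mul_eq_mul_right hn (Nat.pow_right_injective Finite.one_lt_card h1)
  · rintro ⟨W, hW, rfl⟩
    exact codeOf_mem_codes hW

omit [Finite F] in
theorem codeOf_injective (hn : 0 < n) :
    Function.Injective (codeOf : Submodule F (Fin t × Fin n → F) → _) := by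
  intro W W' h
  have key : ∀ (W : Submodule F (Fin t × Fin n → F)) w, w ∈ W ↔ singleRow ⟨0, hn⟩ w ∈ codeOf W := by
    intro W w
    rw [mem_codeOf]
    constructor
    · intro hw a
      rw [flatten_singleRow]
      split_ifs
      exacts [hw, W.zero_mem]
    · intro hw
      have := hw ⟨0, hn⟩
      rwa [flatten_singleRow, if_pos rfl] at this
  ext w
  rw [key W, key W', h]

theorem finite_codes (k : ℕ) : (codes F n t k).Finite := by
  have : Finite (Matrix (Fin n) (Fin n) F) := inferInstanceAs (Finite (Fin n → Fin n → F))
  exact Set.toFinite _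

theorem ncard_codes (hn : 0 < n) (k : ℕ) :
    (codes F n t k).ncard =
      Nat.card {W : Submodule F (Fin t × Fin n → F) // Module.finrank F W = k} := by
  rw [codes_eq_image hn, Set.ncard_image_of_injective _ (codeOf_injective hn)]
  rfl

theorem nonempty_codes {k : ℕ} (hk : k ≤ n * t) : (codes F n t k).Nonempty := by
  have h1 : k ≤ Module.finrank F (Fin t × Fin n → F) := by
    rw [Module.finrank_fintype_fun_eq_card, Fintype.card_prod, Fintype.card_fin, Fintype.card_fin,
      mul_comm]
    exact hk
  have h2 : (Nat.card {W : Submodule F (Fin t × Fin n → F) // Module.finrank F W = k} : ℝ) ≠ 0 := by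
    intro h
    have h3 := natCard_subspaces_mul (F := F) h1
    rw [h, zero_mul] at h3
    exact (frameCount_pos F h1).ne h3
  obtain ⟨W, hW⟩ := (Nat.card_ne_zero.1 (Nat.cast_ne_zero.1 h2)).1
  exact ⟨_, codeOf_mem_codes hW⟩

/-- The proportion of the codes that contain a given tuple of rank `r` is
`∏ i < r, (q ^ k - q ^ i) / (q ^ (nt) - q ^ i)`. -/
theorem ncard_codes_mem_mul (hn : 0 < n) {k : ℕ} (hk : k ≤ n * t) (hk' : n ≤ k)
    (X : Fin t → Matrix (Fin n) (Fin n) F) :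
    (({C ∈ codes F n t k | X ∈ C}.ncard : ℝ)) * frameCount F (n * t) (flatten X).rank =
      (codes F n t k).ncard * frameCount F k (flatten X).rank := by
  have hV : Module.finrank F (Fin t × Fin n → F) = n * t := by
    rw [Module.finrank_fintype_fun_eq_card, Fintype.card_prod, Fintype.card_fin, Fintype.card_fin,
      mul_comm]
  set U := Submodule.span F (Set.range (flatten X).row) with hU
  have hr : (flatten X).rank = Module.finrank F U := Matrix.rank_eq_finrank_span_row _
  have hrn : (flatten X).rank ≤ n := by
    simpa using Matrix.rank_le_card_height (flatten X)
  have h := natCard_superspaces_mul U (k := k) (by omega) (by omega)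
  rw [hV, ← hr, ← ncard_codes hn] at h
  rw [← h]
  congr 2
  have : {C ∈ codes F n t k | X ∈ C} = codeOf '' {W | Module.finrank F W = k ∧ U ≤ W} := by
    rw [codes_eq_image hn]
    ext C
    constructor
    · rintro ⟨⟨W, hW, rfl⟩, hX⟩
      exact ⟨W, ⟨hW, mem_codeOf_iff_span_le.1 hX⟩, rfl⟩
    · rintro ⟨W, ⟨hW, hX⟩, rfl⟩
      exact ⟨⟨W, hW, rfl⟩, mem_codeOf_iff_span_le.2 hX⟩
  rw [this, Set.ncard_image_of_injective _ (codeOf_injective hn)]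
  rfl

end Codes

/-! ### Orders as lattices -/

section Order

variable {K A : Type*} [Field K] [NumberField K] [DivisionRing A] [Algebra K A] [Algebra ℚ A]
  {O : Subalgebra (𝓞 K) A}

omit [Algebra ℚ A] in
theorem IsOrderIn.module_finite_int (hO : IsOrderIn O) : Module.Finite ℤ O := by
  have : Module.Finite (𝓞 K) O := Module.Finite.iff_fg.2 hO.fg
  exact Module.Finite.trans (𝓞 K) O

omit [NumberField K] in
theorem module_free_int [Module.Finite ℤ O] : Module.Free ℤ O := by
  have : CharZero A := algebraRat.charZero A
  have : Module.IsTorsionFree ℤ O :=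
    Function.Injective.moduleIsTorsionFree (Subtype.val : O → A) Subtype.val_injective
      (fun _ _ => rfl)
  exact Module.free_of_finite_type_torsion_free'

omit [Algebra ℚ A] in
/-- Every element of the algebra has a nonzero integer multiple in the order. -/
theorem IsOrderIn.exists_int_smul_mem (hO : IsOrderIn O) (a : A) :
    ∃ n : ℤ, n ≠ 0 ∧ n • a ∈ O := by
  have ha : a ∈ Submodule.span K (O : Set A) := hO.span_eq_top ▸ Submodule.mem_top
  induction ha using Submodule.span_induction with
  | mem x hx => exact ⟨1, one_ne_zero, by rwa [one_smul]⟩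
  | zero => exact ⟨1, one_ne_zero, by rw [smul_zero]; exact O.zero_mem⟩
  | add x y _ _ hx hy =>
    obtain ⟨m, hm, hmx⟩ := hx
    obtain ⟨n, hn, hny⟩ := hy
    refine ⟨m * n, mul_ne_zero hm hn, ?_⟩
    rw [smul_add]
    refine O.add_mem ?_ ?_
    · rw [mul_comm, mul_smul]; exact zsmul_mem hmx n
    · rw [mul_smul]; exact zsmul_mem hny m
  | smul c x _ hx =>
    obtain ⟨n, hn, hnx⟩ := hx
    obtain ⟨y, hy0, hy⟩ := IsAlgebraic.exists_integral_multiple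
      ((IsFractionRing.isAlgebraic_iff ℤ ℚ K).2 (Algebra.IsAlgebraic.isAlgebraic c))
    refine ⟨y * n, mul_ne_zero hy0 hn, ?_⟩
    have h1 : (y * n) • c • x = (⟨y • c, hy⟩ : 𝓞 K) • (n • x) := by
      have h2 : (⟨y • c, hy⟩ : 𝓞 K) • (n • x) = (y • c) • (n • x) := rfl
      rw [h2, mul_smul, smul_comm n c x, smul_assoc]
    rw [h1]
    exact O.smul_mem hnx _

/-- A `ℤ`-basis of the order is a `ℚ`-basis of the algebra. -/
theorem IsOrderIn.exists_rat_basis (hO : IsOrderIn O) {κ : Type*} (b : Module.Basis κ ℤ O) :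
    ∃ bA : Module.Basis κ ℚ A, ∀ i, bA i = (b i : A) := by
  have hli : LinearIndependent ℚ fun i => (b i : A) := by
    rw [← LinearIndependent.iff_fractionRing ℤ ℚ]
    have := b.linearIndependent.map' (O.val.toLinearMap.restrictScalars ℤ)
      (LinearMap.ker_eq_bot.2 Subtype.val_injective)
    exact this
  have hsp : ⊤ ≤ Submodule.span ℚ (Set.range fun i => (b i : A)) := by
    intro a _
    obtain ⟨n, hn, hna⟩ := hO.exists_int_smul_mem a
    have h1 : n • a ∈ Submodule.span ℚ (Set.range fun i => (b i : A)) := by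
      have h2 : (⟨n • a, hna⟩ : O) ∈ Submodule.span ℤ (Set.range b) := by
        rw [b.span_eq]; exact Submodule.mem_top
      have h3 := Submodule.mem_map_of_mem (f := O.val.toLinearMap.restrictScalars ℤ) h2
      rw [Submodule.map_span, ← Set.range_comp] at h3
      exact Submodule.span_subset_span ℤ ℚ _ h3
    have h4 : a = (n : ℚ)⁻¹ • (n • a) := by
      rw [← Int.cast_smul_eq_zsmul ℚ n a, inv_smul_smul₀ (Int.cast_ne_zero.2 hn)]
    rw [h4]
    exact Submodule.smul_mem _ _ h1
  exact ⟨Module.Basis.mk hli hsp, fun i => Module.Basis.mk_apply _ _ i⟩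

variable {t d : ℕ} (ψ : (Fin t → ℝ ⊗[ℚ] A) ≃ₗ[ℝ] EuclideanSpace ℝ (Fin d))

/-- The order `O ^ t` embeds as a full lattice: a `ℤ`-basis goes to an `ℝ`-basis. -/
theorem IsOrderIn.exists_real_basis (hO : IsOrderIn O) {κ : Type*} [Finite κ]
    (b : Module.Basis κ ℤ O) :
    ∃ B : Module.Basis (Σ _ : Fin t, κ) ℝ (EuclideanSpace ℝ (Fin d)),
      ∀ i, B i = embed O ψ (Pi.basis (fun _ : Fin t => b) i) := by
  obtain ⟨bA, hbA⟩ := hO.exists_rat_basis b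
  refine ⟨(Pi.basis fun _ : Fin t => Algebra.TensorProduct.basis ℝ bA).map ψ, fun i => ?_⟩
  rw [Module.Basis.map_apply, Pi.basis_apply, Pi.basis_apply, Algebra.TensorProduct.basis_apply, hbA]
  change _ = ψ _
  congr 1
  funext j
  by_cases h : j = i.1
  · subst h; simp
  · simp [h]

omit [NumberField K] in
theorem embed_eq_sum {κ : Type*} [Fintype κ] (b : Module.Basis κ ℤ O)
    {B : Module.Basis (Σ _ : Fin t, κ) ℝ (EuclideanSpace ℝ (Fin d))}
    (hB : ∀ i, B i = embed O ψ (Pi.basis (fun _ : Fin t => b) i)) (x : Fin t → O) :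
    embed O ψ x = ∑ i, (Pi.basis (fun _ : Fin t => b)).repr x i • B i := by
  conv_lhs => rw [← (Pi.basis (fun _ : Fin t => b)).sum_repr x]
  rw [map_sum]
  refine Finset.sum_congr rfl fun i _ => ?_
  rw [map_zsmul, hB]

omit [NumberField K] in
theorem repr_embed {κ : Type*} [Fintype κ] (b : Module.Basis κ ℤ O)
    {B : Module.Basis (Σ _ : Fin t, κ) ℝ (EuclideanSpace ℝ (Fin d))}
    (hB : ∀ i, B i = embed O ψ (Pi.basis (fun _ : Fin t => b) i)) (x : Fin t → O)
    (i : Σ _ : Fin t, κ) :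
    B.repr (embed O ψ x) i = ((b.repr (x i.1) i.2 : ℤ) : ℝ) := by
  rw [embed_eq_sum ψ b hB]
  simp_rw [← Int.cast_smul_eq_zsmul ℝ]
  rw [B.repr_sum_self fun i => (((Pi.basis (fun _ : Fin t => b)).repr x i : ℤ) : ℝ)]
  simp only [Pi.basis_repr]

omit [NumberField K] in
theorem embed_injective : Function.Injective (embed O ψ) := by
  intro x y h
  have h1 : (fun i => (1 : ℝ) ⊗ₜ[ℚ] (x i : A)) = fun i => (1 : ℝ) ⊗ₜ[ℚ] (y i : A) := ψ.injective h
  funext i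
  exact Subtype.ext (Algebra.TensorProduct.includeRight_injective
    (FaithfulSMul.algebraMap_injective ℚ ℝ) (congrFun h1 i))

omit [NumberField K] in
theorem orderLattice_eq_span {κ : Type*} [Fintype κ] (b : Module.Basis κ ℤ O)
    {B : Module.Basis (Σ _ : Fin t, κ) ℝ (EuclideanSpace ℝ (Fin d))}
    (hB : ∀ i, B i = embed O ψ (Pi.basis (fun _ : Fin t => b) i)) :
    orderLattice O ψ = Submodule.span ℤ (Set.range B) := by
  refine le_antisymm ?_ ?_
  · rintro _ ⟨x, rfl⟩
    rw [embed_eq_sum ψ b hB]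
    exact Submodule.sum_mem _ fun i _ => Submodule.smul_mem _ _ (Submodule.subset_span ⟨i, rfl⟩)
  · rw [Submodule.span_le]
    rintro _ ⟨i, rfl⟩
    rw [hB]
    exact ⟨_, rfl⟩

omit [NumberField K] [Algebra ℚ A] in
/-- A subgroup of the order stable under right multiplication that contains `y ≠ 0` has index at
most `[O : y O]`, the absolute value of the determinant of left multiplication by `y`. -/
theorem index_le_natAbs_det [Module.Free ℤ O] [Module.Finite ℤ O] {J : AddSubgroup O}
    (hJ : ∀ y ∈ J, ∀ z, y * z ∈ J) {y : O} (hy : y ∈ J) (hy0 : y ≠ 0) :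
    J.index ≤ (LinearMap.det (LinearMap.mulLeft ℤ y)).natAbs := by
  set L := LinearMap.mulLeft ℤ y
  have hinj : Function.Injective L := by
    intro u v h
    have h1 : (y : A) * u = y * v := congrArg Subtype.val h
    exact Subtype.ext (mul_left_cancel₀ (fun h0 => hy0 (Subtype.ext h0)) h1)
  have h1 := Submodule.natAbs_det_equiv (LinearMap.range L) (LinearEquiv.ofInjective L hinj)
  have h2 : (LinearMap.range L).subtype ∘ₗ
      ((LinearEquiv.ofInjective L hinj : O ≃+ LinearMap.range L) : O →+ LinearMap.range L).toIntLinearMap = L := by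
    ext; rfl
  have hdet : LinearMap.det L ≠ 0 := by
    intro h0
    exact (LinearMap.bot_lt_ker_of_det_eq_zero h0).ne' (LinearMap.ker_eq_bot.2 hinj)
  have h3 : (LinearMap.det L).natAbs = (LinearMap.range L).toAddSubgroup.index := by
    conv_lhs => rw [← h2]
    exact h1
  rw [h3]
  refine Nat.le_of_dvd ?_ (AddSubgroup.index_dvd_of_le ?_)
  · rw [← h3]
    exact Nat.pos_of_ne_zero (Int.natAbs_ne_zero.2 hdet)
  · rintro _ ⟨z, rfl⟩
    exact hJ y hy z

omit [NumberField K] [Algebra ℚ A] in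
/-- The determinant of left multiplication by `y` is bounded by the power `[A : ℚ]` of the
coordinates of `y`. -/
theorem exists_det_mulLeft_le {κ : Type*} [Fintype κ] (b : Module.Basis κ ℤ O) :
    ∃ M : ℝ, 0 < M ∧ ∀ (y : O) (s : ℝ), (∀ l, |((b.repr y l : ℤ) : ℝ)| ≤ s) →
      ((LinearMap.det (LinearMap.mulLeft ℤ y)).natAbs : ℝ) ≤ M * s ^ Fintype.card κ := by
  classical
  set N := Fintype.card κ
  set c : κ → κ → κ → ℝ := fun l i j => |((b.repr (b l * b j) i : ℤ) : ℝ)|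
  set S : ℝ := 1 + ∑ i, ∑ j, ∑ l, c l i j
  have hc : ∀ l i j, 0 ≤ c l i j := fun l i j => abs_nonneg _
  have hS : 0 < S := by
    have : 0 ≤ ∑ i, ∑ j, ∑ l, c l i j := Finset.sum_nonneg fun i _ => Finset.sum_nonneg fun j _ =>
      Finset.sum_nonneg fun l _ => hc l i j
    linarith
  refine ⟨N.factorial * S ^ N, by positivity, fun y s hs => ?_⟩
  have hent : ∀ i j, |((LinearMap.toMatrix b b (LinearMap.mulLeft ℤ y) i j : ℤ) : ℝ)| ≤ S * s := by
    intro i j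
    have h1 : LinearMap.toMatrix b b (LinearMap.mulLeft ℤ y) i j =
        ∑ l, b.repr y l * b.repr (b l * b j) i := by
      rw [LinearMap.toMatrix_apply, LinearMap.mulLeft_apply]
      conv_lhs => rw [← b.sum_repr y]
      rw [Finset.sum_mul, map_sum, Finsupp.finsetSum_apply]
      refine Finset.sum_congr rfl fun l _ => ?_
      rw [smul_mul_assoc, map_zsmul, Finsupp.smul_apply, smul_eq_mul]
    have hs0 : 0 ≤ s := (abs_nonneg _).trans (hs i)
    rw [h1]
    push_cast
    refine (Finset.abs_sum_le_sum_abs _ _).trans ?_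
    calc ∑ l, |((b.repr y l : ℤ) : ℝ) * ((b.repr (b l * b j) i : ℤ) : ℝ)|
        ≤ ∑ l, s * c l i j := by
          refine Finset.sum_le_sum fun l _ => ?_
          rw [abs_mul]
          exact mul_le_mul_of_nonneg_right (hs l) (hc l i j)
      _ = (∑ l, c l i j) * s := by rw [← Finset.mul_sum, mul_comm]
      _ ≤ S * s := by
          refine mul_le_mul_of_nonneg_right ?_ hs0
          have h2 : ∑ l, c l i j ≤ ∑ j, ∑ l, c l i j := Finset.single_le_sum
            (f := fun j => ∑ l, c l i j) (fun j _ => Finset.sum_nonneg fun l _ => hc l i j)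
            (Finset.mem_univ j)
          have h3 : ∑ j, ∑ l, c l i j ≤ ∑ i, ∑ j, ∑ l, c l i j := Finset.single_le_sum
            (f := fun i => ∑ j, ∑ l, c l i j) (fun i _ => Finset.sum_nonneg fun j _ =>
              Finset.sum_nonneg fun l _ => hc l i j) (Finset.mem_univ i)
          simp only [S]
          linarith
  have h4 := Matrix.det_le (A := (LinearMap.toMatrix b b (LinearMap.mulLeft ℤ y)).map
    (Int.cast : ℤ → ℝ)) (abv := AbsoluteValue.abs) (x := S * s) hent
  have h5 : ((LinearMap.toMatrix b b (LinearMap.mulLeft ℤ y)).map (Int.cast : ℤ → ℝ)).det =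
      ((LinearMap.det (LinearMap.mulLeft ℤ y) : ℤ) : ℝ) := by
    rw [← LinearMap.det_toMatrix b]
    exact (Int.cast_det _).symm
  rw [h5, AbsoluteValue.abs_apply, nsmul_eq_mul] at h4
  rw [Nat.cast_natAbs, Int.cast_abs]
  refine h4.trans_eq ?_
  rw [mul_pow]
  ring

/-- Norm bound: nonzero vectors of `J ^ t`, for `J` a subgroup of the order that is stable under right
multiplication, have norm at least a constant times `[O : J] ^ (1 / [A : ℚ])`. -/
theorem IsOrderIn.exists_norm_bound (hO : IsOrderIn O) {κ : Type*} [Fintype κ]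
    (b : Module.Basis κ ℤ O) :
    ∃ c : ℝ, 0 < c ∧ ∀ J : AddSubgroup O, (∀ y ∈ J, ∀ z, y * z ∈ J) →
      ∀ x : Fin t → O, (∀ j, x j ∈ J) → x ≠ 0 →
        c * J.index ≤ ‖embed O ψ x‖ ^ Fintype.card κ := by
  have := Module.Finite.of_basis b
  have := Module.Free.of_basis b
  obtain ⟨B, hB⟩ := hO.exists_real_basis ψ b
  obtain ⟨M, hM, hdet⟩ := exists_det_mulLeft_le b
  let T := LinearMap.toContinuousLinearMap B.equivFun.toLinearMap
  have hT : ∀ v i, |B.repr v i| ≤ (‖T‖ + 1) * ‖v‖ := by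
    intro v i
    have h1 : ‖T v‖ ≤ ‖T‖ * ‖v‖ := T.le_opNorm v
    have h2 : ‖T v i‖ ≤ ‖T v‖ := norm_le_pi_norm _ i
    have h3 : T v i = B.repr v i := rfl
    rw [h3, Real.norm_eq_abs] at h2
    nlinarith [norm_nonneg v]
  have hT0 : 0 < ‖T‖ + 1 := by positivity
  set N := Fintype.card κ
  refine ⟨(M * (‖T‖ + 1) ^ N)⁻¹, by positivity, fun J hJ x hx hx0 => ?_⟩
  obtain ⟨j, hj⟩ : ∃ j, x j ≠ 0 := by
    by_contra hall
    push Not at hall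
    exact hx0 (funext hall)
  have h1 := index_le_natAbs_det hJ (hx j) hj
  have h2 := hdet (x j) ((‖T‖ + 1) * ‖embed O ψ x‖) fun l => by
    rw [← repr_embed ψ b hB x ⟨j, l⟩]
    exact hT _ _
  have h3 : (J.index : ℝ) ≤ M * ((‖T‖ + 1) * ‖embed O ψ x‖) ^ N := le_trans (by exact_mod_cast h1) h2
  rw [inv_mul_le_iff₀ (by positivity)]
  refine h3.trans_eq ?_
  rw [mul_pow, mul_assoc]

end Order

/-! ### Tuples of low rank -/

section LowRank

variable {K A : Type*} [Field K] [NumberField K] [DivisionRing A] [Algebra K A]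
  {O : Subalgebra (𝓞 K) A} {F : Type*} [Field F] {n t : ℕ}

/-- The elements of the order whose reduction has all its columns in `U`. -/
def columnIdeal (φ : O →+* Matrix (Fin n) (Fin n) F) (U : Submodule F (Fin n → F)) :
    AddSubgroup O where
  carrier := {y | ∀ i, (φ y).col i ∈ U}
  zero_mem' i := by rw [map_zero]; exact U.zero_mem
  add_mem' hx hy i := by rw [map_add]; exact U.add_mem (hx i) (hy i)
  neg_mem' hx i := by rw [map_neg]; exact U.neg_mem (hx i)

omit [NumberField K] in
theorem mul_mem_columnIdeal (φ : O →+* Matrix (Fin n) (Fin n) F) (U : Submodule F (Fin n → F)) :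
    ∀ y ∈ columnIdeal φ U, ∀ z, y * z ∈ columnIdeal φ U := by
  intro y hy z i
  have : (φ (y * z)).col i = ∑ j, φ z j i • (φ y).col j := by
    ext a
    simp [Matrix.col_apply, Matrix.mul_apply, Finset.sum_apply, mul_comm]
  rw [this]
  exact U.sum_mem fun j _ => U.smul_mem _ (hy j)

omit [NumberField K] in
/-- The index of a column ideal is `q ^ (n * (n - dim U))`: each of the `n` columns has to vanish in
`F ^ n / U`. -/
theorem index_columnIdeal [Finite F] {φ : O →+* Matrix (Fin n) (Fin n) F}
    (hφ : Function.Surjective φ) (U : Submodule F (Fin n → F)) :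
    (columnIdeal φ U).index = (Nat.card F ^ (n - Module.finrank F U)) ^ n := by
  let g : O →+ (Fin n → (Fin n → F) ⧸ U) :=
    { toFun := fun y i => U.mkQ ((φ y).col i)
      map_zero' := by
        funext i
        rw [map_zero]
        exact map_zero U.mkQ
      map_add' := fun x y => by
        funext i
        rw [map_add]
        exact map_add U.mkQ _ _ }
  have hker : columnIdeal φ U = g.ker := by
    ext y
    rw [AddMonoidHom.mem_ker, funext_iff]
    exact forall_congr' fun i => (Submodule.Quotient.mk_eq_zero U).symm
  have hsurj : Function.Surjective g := by
    intro v
    choose w hw using fun i => U.mkQ_surjective (v i)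
    obtain ⟨y, hy⟩ := hφ (Matrix.of fun a i => w i a)
    refine ⟨y, funext fun i => ?_⟩
    rw [← hw i]
    change U.mkQ ((φ y).col i) = _
    rw [hy]
    rfl
  have hq := Submodule.finrank_quotient_add_finrank U
  rw [Module.finrank_fin_fun] at hq
  have hd : Module.finrank F ((Fin n → F) ⧸ U) = n - Module.finrank F U := by omega
  rw [hker, AddSubgroup.index_ker, AddMonoidHom.range_eq_top.2 hsurj, AddSubgroup.card_top,
    Nat.card_fun, Module.natCard_eq_pow_finrank (K := F) (V := (Fin n → F) ⧸ U), hd,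
    Nat.card_eq_fintype_card (α := Fin n), Fintype.card_fin]

/-- The rank of the reduction of an element of `O ^ t`, viewed as an `n × tn` matrix. -/
def reductionRank (φ : O →+* Matrix (Fin n) (Fin n) F) (x : Fin t → O) : ℕ :=
  (flatten fun j => φ (x j)).rank

omit [NumberField K] in
theorem reductionRank_le (φ : O →+* Matrix (Fin n) (Fin n) F) (x : Fin t → O) :
    reductionRank φ x ≤ n :=
  (Matrix.rank_le_card_height (flatten fun j => φ (x j))).trans (Fintype.card_fin n).le

omit [NumberField K] in
theorem exists_columnIdeal (φ : O →+* Matrix (Fin n) (Fin n) F) (x : Fin t → O) :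
    ∃ U : Submodule F (Fin n → F), Module.finrank F U = reductionRank φ x ∧
      ∀ j, x j ∈ columnIdeal φ U := by
  refine ⟨Submodule.span F (Set.range (flatten fun j => φ (x j)).col),
    (Matrix.rank_eq_finrank_span_cols _).symm, fun j i => Submodule.subset_span ⟨(j, i), ?_⟩⟩
  rfl

variable [Algebra ℚ A] {d : ℕ} (ψ : (Fin t → ℝ ⊗[ℚ] A) ≃ₗ[ℝ] EuclideanSpace ℝ (Fin d))

/-- The sum of a semi-admissible function over the nonzero vectors of `β • J ^ t` is bounded by a
constant times the inverse of `β ^ d * [O : J] ^ t`, for `J` stable under right multiplication. -/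
theorem IsOrderIn.exists_sum_bound (hO : IsOrderIn O) {κ : Type*} [Fintype κ] [Nonempty κ]
    (b : Module.Basis κ ℤ O) (hd : d = Fintype.card κ * t)
    {f : EuclideanSpace ℝ (Fin d) → ℝ} (hf : IsSemiAdmissible f) :
    ∃ C : ℝ, 0 < C ∧ ∀ J : AddSubgroup O, J.index ≠ 0 → (∀ y ∈ J, ∀ z, y * z ∈ J) →
      ∀ β : ℝ, 0 < β →
        Summable ({x : Fin t → O | (∀ j, x j ∈ J) ∧ x ≠ 0}.indicator
          fun x => |f (β • embed O ψ x)|) ∧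
        ∑' x, {x : Fin t → O | (∀ j, x j ∈ J) ∧ x ≠ 0}.indicator
          (fun x => |f (β • embed O ψ x)|) x ≤ C * (β ^ d * (J.index : ℝ) ^ t)⁻¹ := by
  obtain ⟨C, hC, hpack⟩ := hf.exists_packing_bound
  obtain ⟨c, hc, hnorm⟩ := hO.exists_norm_bound (t := t) ψ b
  set N := Fintype.card κ
  have hN : N ≠ 0 := Fintype.card_ne_zero
  refine ⟨C * (c ^ t)⁻¹, by positivity, fun J hJ0 hJ β hβ => ?_⟩
  have hidx : (0 : ℝ) < J.index := Nat.cast_pos.2 (Nat.pos_of_ne_zero hJ0)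
  -- `ρ ^ N = c * [O : J]`, so that `ρ` bounds the norms from below.
  set ρ : ℝ := (c * J.index) ^ ((N : ℝ)⁻¹) with hρ
  have hρ0 : 0 < ρ := by positivity
  have hρN : ρ ^ N = c * J.index := Real.rpow_inv_natCast_pow (by positivity) hN
  have hmin : ∀ x : Fin t → O, (∀ j, x j ∈ J) → x ≠ 0 → β * ρ ≤ ‖β • embed O ψ x‖ := by
    intro x hx hx0
    rw [norm_smul, Real.norm_of_nonneg hβ.le]
    refine mul_le_mul_of_nonneg_left ?_ hβ.le
    refine le_of_pow_le_pow_left₀ hN (norm_nonneg _) ?_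
    rw [hρN]
    exact hnorm J hJ x hx hx0
  obtain ⟨h1, h2⟩ := hpack
    (fun x : {x : Fin t → O | (∀ j, x j ∈ J) ∧ x ≠ 0} => β • embed O ψ (x : Fin t → O))
    (mul_pos hβ hρ0) (fun x y hxy => by
      rw [← smul_sub, ← map_sub]
      exact hmin _ (fun j => J.sub_mem (x.2.1 j) (y.2.1 j))
        (sub_ne_zero.2 fun h => hxy (Subtype.ext h))) (fun x => hmin x x.2.1 x.2.2)
  refine ⟨summable_subtype_iff_indicator.1 h1, ?_⟩
  rw [← tsum_subtype {x : Fin t → O | (∀ j, x j ∈ J) ∧ x ≠ 0} fun x => |f (β • embed O ψ x)|]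
  refine h2.trans_eq ?_
  have hρd : ρ ^ d = c ^ t * (J.index : ℝ) ^ t := by
    rw [hd, pow_mul, hρN, mul_pow]
  rw [mul_pow, hρd, mul_assoc]
  congr 1
  rw [← mul_inv]
  congr 1
  ring

/-- The contribution of the vectors whose reduction has rank `r < n`: these vectors are covered by the
sublattices `J ^ t`, with `J` the column ideals of the `r`-dimensional subspaces. -/
theorem IsOrderIn.exists_rank_sum_bound (hO : IsOrderIn O) {κ : Type*} [Fintype κ] [Nonempty κ]
    (b : Module.Basis κ ℤ O) (hd : d = Fintype.card κ * t)
    {f : EuclideanSpace ℝ (Fin d) → ℝ} (hf : IsSemiAdmissible f) :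
    ∃ C : ℝ, 0 < C ∧ ∀ (F : Type*) [Field F] [Finite F] (φ : O →+* Matrix (Fin n) (Fin n) F),
      Function.Surjective φ → ∀ β : ℝ, 0 < β → ∀ r ≤ n,
        Summable ({x : Fin t → O | reductionRank φ x = r ∧ x ≠ 0}.indicator
          fun x => |f (β • embed O ψ x)|) ∧
        (∑' x, {x : Fin t → O | reductionRank φ x = r ∧ x ≠ 0}.indicator
          (fun x => |f (β • embed O ψ x)|) x) * (Nat.card F : ℝ) ^ (r * r) ≤
          C * (Nat.card F : ℝ) ^ (r * n) *
            (β ^ d * (Nat.card F : ℝ) ^ ((n - r) * n * t))⁻¹ := by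
  obtain ⟨C, hC, hsum⟩ := hO.exists_sum_bound ψ b hd hf
  refine ⟨2 ^ n * C, by positivity, fun F _ _ φ hφ β hβ r hr => ?_⟩
  have hq := one_lt_natCard (F := F)
  set q : ℝ := (Nat.card F : ℝ)
  have := Fintype.ofFinite {U : Submodule F (Fin n → F) // Module.finrank F U = r}
  set h : (Fin t → O) → ℝ := fun x => |f (β • embed O ψ x)|
  set S : {U : Submodule F (Fin n → F) // Module.finrank F U = r} → Set (Fin t → O) :=
    fun U => {x | (∀ j, x j ∈ columnIdeal φ U.1) ∧ x ≠ 0}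
  set R : Set (Fin t → O) := {x | reductionRank φ x = r ∧ x ≠ 0}
  have hidx : ∀ U : {U : Submodule F (Fin n → F) // Module.finrank F U = r},
      (columnIdeal φ U.1).index = (Nat.card F ^ (n - r)) ^ n := fun U => by
    rw [index_columnIdeal hφ, U.2]
  have hS := fun U : {U : Submodule F (Fin n → F) // Module.finrank F U = r} =>
    hsum (columnIdeal φ U.1) (by rw [hidx]; exact pow_ne_zero _ (pow_ne_zero _ Nat.card_pos.ne'))
      (mul_mem_columnIdeal φ U.1) β hβ
  have hle : ∀ x, R.indicator h x ≤ ∑ U, (S U).indicator h x := by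
    intro x
    have h0 : ∀ U ∈ Finset.univ, 0 ≤ (S U).indicator h x := fun U _ =>
      Set.indicator_nonneg (fun _ _ => abs_nonneg _) x
    by_cases hx : x ∈ R
    · obtain ⟨U, hU, hxU⟩ := exists_columnIdeal φ x
      refine le_trans ?_ (Finset.single_le_sum h0 (Finset.mem_univ ⟨U, hU.trans hx.1⟩))
      rw [Set.indicator_of_mem hx, Set.indicator_of_mem]
      exact ⟨hxU, hx.2⟩
    · rw [Set.indicator_of_notMem hx]
      exact Finset.sum_nonneg h0
  have hsS : Summable fun x => ∑ U, (S U).indicator h x := summable_sum fun U _ => (hS U).1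
  have hsR : Summable (R.indicator h) := Summable.of_nonneg_of_le
    (fun x => Set.indicator_nonneg (fun _ _ => abs_nonneg _) x) hle hsS
  refine ⟨hsR, ?_⟩
  set D : ℝ := C * (β ^ d * q ^ ((n - r) * n * t))⁻¹ with hD
  have hD0 : 0 ≤ D := by positivity
  have h1 : ∑' x, R.indicator h x ≤
      Nat.card {U : Submodule F (Fin n → F) // Module.finrank F U = r} * D := by
    refine (hsR.tsum_le_tsum hle hsS).trans ?_
    rw [Summable.tsum_finsetSum fun U _ => (hS U).1]
    refine (Finset.sum_le_sum fun U _ => (hS U).2).trans_eq ?_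
    simp only [hidx, Finset.sum_const, Finset.card_univ, nsmul_eq_mul, ← Nat.card_eq_fintype_card, hD]
    push_cast
    rw [← pow_mul, ← pow_mul, mul_assoc (n - r) n t]
  have h2 := natCard_subspaces_le (F := F) (V := Fin n → F) (r := r)
    (by rw [Module.finrank_fin_fun]; exact hr)
  rw [Module.finrank_fin_fun] at h2
  have h3 : (2 : ℝ) ^ r ≤ 2 ^ n := pow_le_pow_right₀ one_le_two hr
  calc (∑' x, R.indicator h x) * q ^ (r * r)
      ≤ (Nat.card {U : Submodule F (Fin n → F) // Module.finrank F U = r} * D) * q ^ (r * r) := by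
        gcongr
    _ = (Nat.card {U : Submodule F (Fin n → F) // Module.finrank F U = r} * q ^ (r * r)) * D := by
        ring
    _ ≤ (2 ^ r * q ^ (r * n)) * D := by gcongr
    _ ≤ (2 ^ n * q ^ (r * n)) * D := by gcongr
    _ = _ := by rw [hD]; ring

end LowRank

/-! ### Lattices of codes -/

section Covolume

/-- Dilating a full lattice in `ℝ ^ d` by `β` multiplies its covolume by `β ^ d`. -/
theorem covolume_smul {d : ℕ} (L : Submodule ℤ (EuclideanSpace ℝ (Fin d))) [DiscreteTopology L]
    [IsZLattice ℝ L] {β : ℝ} (hβ : 0 < β) :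
    ZLattice.covolume (β • L) = β ^ d * ZLattice.covolume L := by
  have := ZLattice.module_free ℝ L
  have := ZLattice.module_finite ℝ L
  let B := (Module.Free.chooseBasis ℤ L).ofZLatticeBasis ℝ
  have hB : Submodule.span ℤ (Set.range B) = L :=
    (Module.Free.chooseBasis ℤ L).ofZLatticeBasis_span ℝ
  have key : ZLattice.covolume (β • Submodule.span ℤ (Set.range B)) =
      β ^ d * ZLattice.covolume (Submodule.span ℤ (Set.range B)) := by
    let e : EuclideanSpace ℝ (Fin d) ≃ₗ[ℝ] EuclideanSpace ℝ (Fin d) :=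
      LinearEquiv.smulOfNeZero ℝ _ β hβ.ne'
    have h1 : (B.isUnitSMul fun _ => hβ.ne'.isUnit) = B.map e := by
      ext i : 1
      rw [Module.Basis.isUnitSMul_apply, Module.Basis.map_apply]
      rfl
    rw [ZSpan.smul B hβ.ne', h1,
      ZLattice.covolume_eq_measure_fundamentalDomain _ volume
        (ZSpan.isAddFundamentalDomain (B.map e) volume),
      ZLattice.covolume_eq_measure_fundamentalDomain _ volume
        (ZSpan.isAddFundamentalDomain B volume), ← ZSpan.map_fundamentalDomain]
    have h2 : e '' ZSpan.fundamentalDomain B = β • ZSpan.fundamentalDomain B := rfl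
    rw [h2, measureReal_def, Measure.addHaar_smul, ENNReal.toReal_mul,
      ENNReal.toReal_ofReal (abs_nonneg _), finrank_euclideanSpace_fin, abs_of_pos (by positivity)]
    rfl
  rwa [hB] at key

variable {K A : Type*} [Field K] [NumberField K] [DivisionRing A] [Algebra K A] [Algebra ℚ A]
  {O : Subalgebra (𝓞 K) A} {t d n k : ℕ}
  (ψ : (Fin t → ℝ ⊗[ℚ] A) ≃ₗ[ℝ] EuclideanSpace ℝ (Fin d))
  {F : Type*} [Field F] (φ : O →+* Matrix (Fin n) (Fin n) F)

omit [NumberField K] in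
theorem embed_mem_codeLattice
    {C : Submodule (Matrix (Fin n) (Fin n) F) (Fin t → Matrix (Fin n) (Fin n) F)} {x : Fin t → O} :
    embed O ψ x ∈ codeLattice ψ φ C ↔ (fun j => φ (x j)) ∈ C := by
  constructor
  · rintro ⟨y, hy, h⟩
    rw [← embed_injective ψ h]
    exact hy
  · intro h
    exact ⟨x, h, rfl⟩

omit [NumberField K] in
theorem mem_smul_codeLattice {β : ℝ}
    {C : Submodule (Matrix (Fin n) (Fin n) F) (Fin t → Matrix (Fin n) (Fin n) F)}
    {v : EuclideanSpace ℝ (Fin d)} : v ∈ β • codeLattice ψ φ C ↔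
      ∃ x : Fin t → O, (fun j => φ (x j)) ∈ C ∧ v = β • embed O ψ x := by
  constructor
  · rintro ⟨_, ⟨x, hx, rfl⟩, rfl⟩
    exact ⟨x, hx, rfl⟩
  · rintro ⟨x, hx, rfl⟩
    exact ⟨_, ⟨x, hx, rfl⟩, rfl⟩

omit [NumberField K] in
theorem smul_embed_mem {β : ℝ} (hβ : 0 < β)
    {C : Submodule (Matrix (Fin n) (Fin n) F) (Fin t → Matrix (Fin n) (Fin n) F)} {x : Fin t → O} :
    β • embed O ψ x ∈ β • codeLattice ψ φ C ↔ (fun j => φ (x j)) ∈ C := by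
  rw [mem_smul_codeLattice]
  constructor
  · rintro ⟨y, hy, h⟩
    rwa [embed_injective ψ (smul_right_injective _ hβ.ne' h)]
  · intro h
    exact ⟨x, h, rfl⟩

omit [NumberField K] in
theorem codeLattice_le (C : Submodule (Matrix (Fin n) (Fin n) F) (Fin t → Matrix (Fin n) (Fin n) F)) :
    codeLattice ψ φ C ≤ orderLattice O ψ := by
  rintro _ ⟨x, -, rfl⟩
  exact ⟨x, rfl⟩

omit [NumberField K] in
/-- Different codes have different preimages. -/
theorem smul_codeLattice_injective (hφ : Function.Surjective φ) {β : ℝ} (hβ : 0 < β) :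
    Function.Injective fun C : Submodule (Matrix (Fin n) (Fin n) F)
      (Fin t → Matrix (Fin n) (Fin n) F) => β • codeLattice ψ φ C := by
  intro C C' h
  ext X
  choose x hx using fun j => hφ (X j)
  have h1 : (fun j => φ (x j)) = X := funext hx
  have h2 := smul_embed_mem ψ φ hβ (C := C) (x := x)
  rw [show β • codeLattice ψ φ C = β • codeLattice ψ φ C' from h, smul_embed_mem ψ φ hβ, h1] at h2
  exact h2.symm

variable [Finite F]

omit [NumberField K] [Algebra ℚ A] [Finite F] in
theorem index_comap_code (hφ : Function.Surjective φ)
    {C : Submodule (Matrix (Fin n) (Fin n) F) (Fin t → Matrix (Fin n) (Fin n) F)}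
    (hC : C ∈ codes F n t k) :
    (C.toAddSubgroup.comap (φ.toAddMonoidHom.compLeft (Fin t))).index * Nat.card F ^ (k * n) =
      Nat.card F ^ (n * n * t) := by
  have hsurj : Function.Surjective (φ.toAddMonoidHom.compLeft (Fin t)) := by
    intro X
    choose x hx using fun j => hφ (X j)
    exact ⟨x, funext hx⟩
  rw [AddSubgroup.index_comap_of_surjective _ hsurj, ← natCard_of_mem_codes hC]
  have h := AddSubgroup.index_mul_card C.toAddSubgroup
  have h2 : Nat.card (Matrix (Fin n) (Fin n) F) = Nat.card F ^ (n * n) := by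
    change Nat.card (Fin n → Fin n → F) = _
    rw [Nat.card_fun, Nat.card_fun, Nat.card_eq_fintype_card (α := Fin n), Fintype.card_fin, pow_mul]
  rw [Nat.card_fun, h2, Nat.card_eq_fintype_card (α := Fin t), Fintype.card_fin, ← pow_mul] at h
  exact h

/-- The rescaled preimages of the codes all have the covolume of `O ^ t` times the product of the
scaling factor `β ^ d` and the index `q ^ (n * n * t - k * n)`. -/
theorem IsOrderIn.covolume_codeLattice (hO : IsOrderIn O) (hφ : Function.Surjective φ)
    {C : Submodule (Matrix (Fin n) (Fin n) F) (Fin t → Matrix (Fin n) (Fin n) F)}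
    (hC : C ∈ codes F n t k) {β : ℝ} (hβ : 0 < β) :
    ZLattice.covolume (β • codeLattice ψ φ C) * (Nat.card F : ℝ) ^ (k * n) =
      β ^ d * (Nat.card F : ℝ) ^ (n * n * t) * ZLattice.covolume (orderLattice O ψ) := by
  have := hO.module_finite_int
  have := module_free_int (O := O)
  obtain ⟨B, hB⟩ := hO.exists_real_basis ψ (Module.Free.chooseBasis ℤ O)
  have hL := orderLattice_eq_span ψ _ hB
  have hd : DiscreteTopology (orderLattice O ψ) := by rw [hL]; infer_instance
  have hz : IsZLattice ℝ (orderLattice O ψ) := by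
    constructor
    rw [hL]
    exact ZSpan.span_top B
  have hle := codeLattice_le ψ φ C
  have hd' : DiscreteTopology (codeLattice ψ φ C) :=
    DiscreteTopology.of_subset (s := (orderLattice O ψ : Set _)) hd hle
  -- Multiplication by `q` maps `O ^ t` into the preimage of any code.
  have hmem : ∀ x : Fin t → O, (fun j => φ ((Nat.card F • x) j)) ∈ C := by
    intro x
    have : (fun j => φ ((Nat.card F • x) j)) = 0 := by
      funext j
      rw [Pi.smul_apply, map_nsmul, nsmul_eq_mul]
      have h0 : ((Nat.card F : ℕ) : F) = 0 := by
        have := Fintype.ofFinite F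
        rw [Nat.card_eq_fintype_card]
        exact Nat.cast_card_eq_zero F
      have h1 : ((Nat.card F : ℕ) : Matrix (Fin n) (Fin n) F) = 0 := by
        rw [← map_natCast (algebraMap F (Matrix (Fin n) (Fin n) F)), h0, map_zero]
      rw [h1, zero_mul, Pi.zero_apply]
    rw [this]
    exact C.zero_mem
  have hz' : IsZLattice ℝ (codeLattice ψ φ C) := by
    constructor
    rw [eq_top_iff, ← hz.span_top, Submodule.span_le]
    rintro _ ⟨x, rfl⟩
    have hq : ((Nat.card F : ℕ) : ℝ) ≠ 0 := Nat.cast_ne_zero.2 Nat.card_pos.ne'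
    have h1 : embed O ψ x = ((Nat.card F : ℕ) : ℝ)⁻¹ • embed O ψ (Nat.card F • x) := by
      rw [map_nsmul, ← Nat.cast_smul_eq_nsmul ℝ, inv_smul_smul₀ hq]
    rw [h1]
    exact Submodule.smul_mem _ _ (Submodule.subset_span
      ((embed_mem_codeLattice ψ φ).2 (hmem x)))
  have h1 := ZLattice.covolume_div_covolume_eq_relIndex' (codeLattice ψ φ C) (orderLattice O ψ) hle
  have h2 : (codeLattice ψ φ C).toAddSubgroup.relIndex (orderLattice O ψ).toAddSubgroup =
      (C.toAddSubgroup.comap (φ.toAddMonoidHom.compLeft (Fin t))).index := by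
    have h3 := AddSubgroup.relIndex_map_map_of_injective
      (C.toAddSubgroup.comap (φ.toAddMonoidHom.compLeft (Fin t))) ⊤ (embed_injective (O := O) ψ)
    rw [AddSubgroup.relIndex_top_right, ← AddMonoidHom.range_eq_map] at h3
    exact h3
  have hV := ZLattice.covolume_pos (orderLattice O ψ) volume
  rw [h2, div_eq_iff hV.ne'] at h1
  have h3 : ((C.toAddSubgroup.comap (φ.toAddMonoidHom.compLeft (Fin t))).index : ℝ) *
      (Nat.card F : ℝ) ^ (k * n) = (Nat.card F : ℝ) ^ (n * n * t) := by
    exact_mod_cast index_comap_code φ hφ hC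
  rw [covolume_smul _ hβ, h1, ← h3]
  ring

omit [Finite F] in
/-- For a vector `x` of `O ^ t` with nonzero reduction, being primitive in the preimage of a code that
contains the reduction is the same as being primitive in `O ^ t`: an integer dividing `x` is then
invertible in `F`, so that the quotient has its reduction in the code as well. -/
theorem IsOrderIn.smul_embed_mem_primitiveVectors_iff (hO : IsOrderIn O)
    {C : Submodule (Matrix (Fin n) (Fin n) F) (Fin t → Matrix (Fin n) (Fin n) F)} {β : ℝ}
    (hβ : 0 < β) {x : Fin t → O} (hx : (fun j => φ (x j)) ≠ 0) :
    β • embed O ψ x ∈ primitiveVectors (β • codeLattice ψ φ C) ↔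
      (fun j => φ (x j)) ∈ C ∧ embed O ψ x ∈ primitiveVectors (orderLattice O ψ) := by
  have := hO.module_finite_int
  have := module_free_int (O := O)
  obtain ⟨B, hB⟩ := hO.exists_real_basis ψ (Module.Free.chooseBasis ℤ O)
  have hL := orderLattice_eq_span ψ _ hB
  constructor
  · rintro ⟨hmem, hne, hmin⟩
    have hxC := (smul_embed_mem ψ φ hβ).1 hmem
    refine ⟨hxC, ?_⟩
    have hxL : embed O ψ x ∈ Submodule.span ℤ (Set.range B) := hL ▸ ⟨x, rfl⟩
    rw [hL]
    refine (mem_primitiveVectors_iff_content B ⟨_, hxL⟩).2 ?_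
    set g := content (B.restrictScalars ℤ) ⟨_, hxL⟩ with hg
    obtain ⟨⟨y, hyL⟩, hy⟩ := (dvd_content_iff (B.restrictScalars ℤ)).1 (dvd_refl g)
    rw [← hL] at hyL
    obtain ⟨x', rfl⟩ := hyL
    have hxx : embed O ψ x = embed O ψ (g • x') := by
      rw [map_nsmul]
      exact congrArg Subtype.val hy
    have hx' : x = g • x' := embed_injective ψ hxx
    have hgF : (g : F) ≠ 0 := by
      intro h0
      refine hx (funext fun j => ?_)
      have h1 : ((g : ℕ) : Matrix (Fin n) (Fin n) F) = 0 := by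
        rw [← map_natCast (algebraMap F (Matrix (Fin n) (Fin n) F)), h0, map_zero]
      rw [hx', Pi.smul_apply, map_nsmul, nsmul_eq_mul, h1, zero_mul, Pi.zero_apply]
    have hx'C : (fun j => φ (x' j)) ∈ C := by
      have h1 : (fun j => φ (x' j)) = Matrix.scalar (Fin n) (g : F)⁻¹ • fun j => φ (x j) := by
        funext j
        rw [Pi.smul_apply, hx', Pi.smul_apply, map_nsmul, nsmul_eq_mul, smul_eq_mul,
          ← map_natCast (Matrix.scalar (Fin n) : F →+* Matrix (Fin n) (Fin n) F), ← mul_assoc,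
          ← map_mul, inv_mul_cancel₀ hgF, map_one, one_mul]
      rw [h1]
      exact C.smul_mem _ hxC
    have hgR : (g : ℝ) ≠ 0 := by
      intro h0
      rw [Nat.cast_eq_zero.1 h0, Nat.cast_zero] at hgF
      exact hgF rfl
    have hxg : embed O ψ x = (g : ℝ) • embed O ψ x' := by
      rw [hxx, map_nsmul, Nat.cast_smul_eq_nsmul]
    have hne' : embed O ψ x' ≠ 0 := by
      intro h0
      rw [hxg, h0, smul_zero, smul_zero] at hne
      exact hne rfl
    have h2 := hmin (β • embed O ψ x') ((smul_embed_mem ψ φ hβ).2 hx'C)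
      (smul_ne_zero hβ.ne' hne') (Submodule.mem_span_singleton.2 ⟨(g : ℝ)⁻¹, by
        rw [hxg, smul_comm β, inv_smul_smul₀ hgR]⟩)
    rw [hxg, smul_comm β, norm_smul, Real.norm_natCast] at h2
    have h3 : (g : ℝ) ≤ 1 := by
      have := norm_pos_iff.2 (smul_ne_zero hβ.ne' hne')
      by_contra hlt
      push Not at hlt
      nlinarith
    have h4 : g ≤ 1 := by exact_mod_cast h3
    have h5 : g ≠ 0 := Nat.cast_ne_zero.1 hgR
    omega
  · rintro ⟨hxC, -, hne, hmin⟩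
    refine ⟨(smul_embed_mem ψ φ hβ).2 hxC, smul_ne_zero hβ.ne' hne, fun v hv hv0 hvs => ?_⟩
    obtain ⟨y, -, rfl⟩ := (mem_smul_codeLattice ψ φ).1 hv
    obtain ⟨r, hr⟩ := Submodule.mem_span_singleton.1 hvs
    rw [norm_smul, norm_smul]
    refine mul_le_mul_of_nonneg_left (hmin _ ⟨y, rfl⟩ (fun h0 => hv0 (by rw [h0, smul_zero]))
      (Submodule.mem_span_singleton.2 ⟨r, ?_⟩)) (norm_nonneg _)
    rw [smul_comm] at hr
    exact smul_right_injective _ hβ.ne' hr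

end Covolume

/-! ### Averages over the codes -/

section Density

variable (F : Type*) [Field F] [Finite F]

/-- The proportion of the `k`-dimensional subspaces of an `N`-dimensional space over `F` that contain
a given `r`-dimensional subspace. -/
def codeDensity (N k r : ℕ) : ℝ := frameCount F k r / frameCount F N r

theorem codeDensity_pos {N k r : ℕ} (hr : r ≤ k) (hk : k ≤ N) : 0 < codeDensity F N k r :=
  div_pos (frameCount_pos F hr) (frameCount_pos F (hr.trans hk))

theorem codeDensity_anti {N k r n : ℕ} (hrn : r ≤ n) (hnk : n ≤ k) (hk : k ≤ N) :
    codeDensity F N k n ≤ codeDensity F N k r := by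
  induction n, hrn using Nat.le_induction with
  | base => exact le_rfl
  | succ i hi ih =>
    refine le_trans ?_ (ih (by omega))
    have hq := one_lt_natCard (F := F)
    have h1 : (Nat.card F : ℝ) ^ i < (Nat.card F : ℝ) ^ k := pow_lt_pow_right₀ hq (by omega)
    have h2 : (Nat.card F : ℝ) ^ k ≤ (Nat.card F : ℝ) ^ N := pow_le_pow_right₀ hq.le hk
    have h3 : codeDensity F N k (i + 1) = codeDensity F N k i *
        (((Nat.card F : ℝ) ^ k - (Nat.card F : ℝ) ^ i) /
          ((Nat.card F : ℝ) ^ N - (Nat.card F : ℝ) ^ i)) := by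
      rw [codeDensity, codeDensity, frameCount, frameCount, Finset.prod_range_succ,
        Finset.prod_range_succ, div_mul_div_comm]
      rfl
    rw [h3]
    refine mul_le_of_le_one_right (codeDensity_pos F (by omega) hk).le ?_
    rw [div_le_one (by linarith)]
    linarith

/-- `codeDensity F N k r` is at most `q ^ ((k - N) * r)`. -/
theorem codeDensity_mul_le {N k r : ℕ} (hr : r ≤ k) (hk : k ≤ N) :
    codeDensity F N k r * (Nat.card F : ℝ) ^ (N * r) ≤ (Nat.card F : ℝ) ^ (k * r) := by
  have hq := one_lt_natCard (F := F)
  rw [codeDensity, frameCount, frameCount, ← Finset.prod_div_distrib, pow_mul, pow_mul]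
  have h1 : ∀ c : ℝ, c ^ r = ∏ _i ∈ Finset.range r, c := fun c => by simp
  rw [h1 ((Nat.card F : ℝ) ^ N), h1 ((Nat.card F : ℝ) ^ k), ← Finset.prod_mul_distrib]
  have h2 : (Nat.card F : ℝ) ^ k ≤ (Nat.card F : ℝ) ^ N := pow_le_pow_right₀ hq.le hk
  refine Finset.prod_le_prod (fun i hi => ?_) fun i hi => ?_ <;>
    have hi' : (Nat.card F : ℝ) ^ i < (Nat.card F : ℝ) ^ k :=
      pow_lt_pow_right₀ hq ((Finset.mem_range.1 hi).trans_le hr)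
  · exact mul_nonneg (div_nonneg (by linarith) (by linarith)) (by positivity)
  · rw [div_mul_eq_mul_div, div_le_iff₀ (by linarith)]
    have h3 : 0 ≤ (Nat.card F : ℝ) ^ i := by positivity
    nlinarith

/-- After normalisation, the proportion of the codes that contain a given tuple of full rank tends to
`1` as the field grows. -/
theorem tendsto_codeDensity {α : Type*} {l : Filter α} (Fa : α → Type*) [∀ a, Field (Fa a)]
    [∀ a, Finite (Fa a)] (hq : Tendsto (fun a => (Nat.card (Fa a) : ℝ)) l atTop)
    {N k n : ℕ} (hnk : n ≤ k) (hk : k ≤ N) :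
    Tendsto (fun a => codeDensity (Fa a) N k n *
      ((Nat.card (Fa a) : ℝ) ^ (N * n) / (Nat.card (Fa a) : ℝ) ^ (k * n))) l (𝓝 1) := by
  have hlim : Tendsto (fun q : ℝ => ∏ i ∈ Finset.range n,
      ((1 - (q ^ (k - i))⁻¹) / (1 - (q ^ (N - i))⁻¹))) atTop (𝓝 1) := by
    have h1 : ∀ j : ℕ, 0 < j → Tendsto (fun q : ℝ => 1 - (q ^ j)⁻¹) atTop (𝓝 1) := by
      intro j hj
      have := (tendsto_inv_atTop_zero.comp (tendsto_pow_atTop (α := ℝ) hj.ne')).const_sub 1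
      rwa [sub_zero] at this
    have h2 : 𝓝 (1 : ℝ) = 𝓝 (∏ i ∈ Finset.range n, (1 / 1 : ℝ)) := by simp
    rw [h2]
    refine tendsto_finsetProd _ fun i hi => ?_
    have hi' := Finset.mem_range.1 hi
    exact (h1 (k - i) (by omega)).div (h1 (N - i) (by omega)) one_ne_zero
  refine (hlim.comp hq).congr fun a => ?_
  have hq1 := one_lt_natCard (F := Fa a)
  have h1 : ∀ c : ℝ, c ^ n = ∏ _i ∈ Finset.range n, c := fun c => by simp
  rw [Function.comp_apply, codeDensity, frameCount, frameCount, ← Finset.prod_div_distrib,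
    pow_mul, pow_mul, h1 ((Nat.card (Fa a) : ℝ) ^ N), h1 ((Nat.card (Fa a) : ℝ) ^ k),
    ← Finset.prod_div_distrib, ← Finset.prod_mul_distrib]
  refine Finset.prod_congr rfl fun i hi => ?_
  have hi' := Finset.mem_range.1 hi
  have hq0 : (Nat.card (Fa a) : ℝ) ≠ 0 := by positivity
  have e1 : (Nat.card (Fa a) : ℝ) ^ k =
      (Nat.card (Fa a) : ℝ) ^ (k - i) * (Nat.card (Fa a) : ℝ) ^ i := by
    rw [← pow_add]; congr 1; omega
  have e2 : (Nat.card (Fa a) : ℝ) ^ N =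
      (Nat.card (Fa a) : ℝ) ^ (N - i) * (Nat.card (Fa a) : ℝ) ^ i := by
    rw [← pow_add]; congr 1; omega
  have e3 : (1 : ℝ) < (Nat.card (Fa a) : ℝ) ^ (N - i) := one_lt_pow₀ hq1 (by omega)
  have e4 : (1 : ℝ) < (Nat.card (Fa a) : ℝ) ^ (k - i) := one_lt_pow₀ hq1 (by omega)
  have e5 : 0 < (Nat.card (Fa a) : ℝ) ^ i := by positivity
  rw [e1, e2]
  generalize (Nat.card (Fa a) : ℝ) ^ (N - i) = x at *
  generalize (Nat.card (Fa a) : ℝ) ^ (k - i) = y at *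
  generalize (Nat.card (Fa a) : ℝ) ^ i = z at *
  have hx : x - 1 ≠ 0 := by linarith
  have hxz : x * z - z ≠ 0 := by
    have : x * z - z = (x - 1) * z := by ring
    rw [this]
    exact mul_ne_zero hx e5.ne'
  have hx1 : 1 - x⁻¹ ≠ 0 := by
    have : 1 - x⁻¹ = (x - 1) / x := by field_simp
    rw [this]
    exact div_ne_zero hx (by linarith)
  have hx0 : x ≠ 0 := by linarith
  have hy0 : y ≠ 0 := by linarith
  field_simp

end Density

section Average

variable {K A : Type*} [Field K] [NumberField K] [DivisionRing A] [Algebra K A] [Algebra ℚ A]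
  {O : Subalgebra (𝓞 K) A} {t d n k : ℕ}
  (ψ : (Fin t → ℝ ⊗[ℚ] A) ≃ₗ[ℝ] EuclideanSpace ℝ (Fin d))

/-- The vectors of `O ^ t` that become primitive vectors of `β • L`, for `L` the preimage of `C`. -/
def primitiveIn {F : Type*} [Field F] (φ : O →+* Matrix (Fin n) (Fin n) F) (β : ℝ)
    (C : Submodule (Matrix (Fin n) (Fin n) F) (Fin t → Matrix (Fin n) (Fin n) F)) :
    Set (Fin t → O) :=
  {x | β • embed O ψ x ∈ primitiveVectors (β • codeLattice ψ φ C)}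

omit [NumberField K] in
theorem ne_zero_of_mem_primitiveIn {F : Type*} [Field F] {φ : O →+* Matrix (Fin n) (Fin n) F}
    {β : ℝ} {C : Submodule (Matrix (Fin n) (Fin n) F) (Fin t → Matrix (Fin n) (Fin n) F)}
    {x : Fin t → O} (hx : x ∈ primitiveIn ψ φ β C) : x ≠ 0 := by
  rintro rfl
  exact hx.2.1 (by rw [map_zero, smul_zero])

/-- The primitive vectors of `β • L` are parametrised by vectors of `O ^ t`. -/
def primitiveInEquiv {F : Type*} [Field F] (φ : O →+* Matrix (Fin n) (Fin n) F) {β : ℝ} (hβ : 0 < β)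
    (C : Submodule (Matrix (Fin n) (Fin n) F) (Fin t → Matrix (Fin n) (Fin n) F)) :
    primitiveIn ψ φ β C ≃ primitiveVectors (β • codeLattice ψ φ C) :=
  Equiv.ofBijective (fun x => ⟨β • embed O ψ x, x.2⟩) <| by
    constructor
    · intro x y h
      exact Subtype.ext (embed_injective ψ (smul_right_injective _ hβ.ne' (congrArg Subtype.val h)))
    · rintro ⟨v, hv⟩
      obtain ⟨x, -, rfl⟩ := (mem_smul_codeLattice ψ φ).1 hv.1
      exact ⟨⟨x, hv⟩, rfl⟩

omit [NumberField K] in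
theorem tsum_primitiveVectors {F : Type*} [Field F] (φ : O →+* Matrix (Fin n) (Fin n) F) {β : ℝ}
    (hβ : 0 < β)
    (C : Submodule (Matrix (Fin n) (Fin n) F) (Fin t → Matrix (Fin n) (Fin n) F))
    (f : EuclideanSpace ℝ (Fin d) → ℝ) :
    ∑' v : primitiveVectors (β • codeLattice ψ φ C), f v =
      ∑' x, (primitiveIn ψ φ β C).indicator (fun x => f (β • embed O ψ x)) x := by
  rw [← tsum_subtype, ← (primitiveInEquiv ψ φ hβ C).tsum_eq]
  rfl

omit [NumberField K] in
theorem summable_primitiveVectors_iff {F : Type*} [Field F] (φ : O →+* Matrix (Fin n) (Fin n) F)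
    {β : ℝ} (hβ : 0 < β)
    (C : Submodule (Matrix (Fin n) (Fin n) F) (Fin t → Matrix (Fin n) (Fin n) F))
    (f : EuclideanSpace ℝ (Fin d) → ℝ) :
    (Summable fun v : primitiveVectors (β • codeLattice ψ φ C) => f v) ↔
      Summable ((primitiveIn ψ φ β C).indicator fun x => f (β • embed O ψ x)) := by
  rw [← summable_subtype_iff_indicator, ← (primitiveInEquiv ψ φ hβ C).summable_iff]
  rfl

/-- A semi-admissible function is summable over any set of nonzero vectors of `β • O ^ t`. -/
theorem IsOrderIn.summable_indicator (hO : IsOrderIn O) {κ : Type*} [Fintype κ] [Nonempty κ]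
    (b : Module.Basis κ ℤ O) (hd : d = Fintype.card κ * t)
    {f : EuclideanSpace ℝ (Fin d) → ℝ} (hf : IsSemiAdmissible f) {β : ℝ} (hβ : 0 < β)
    {S : Set (Fin t → O)} (hS : ∀ x ∈ S, x ≠ 0) :
    Summable (S.indicator fun x => f (β • embed O ψ x)) := by
  obtain ⟨C, -, h⟩ := hO.exists_sum_bound ψ b hd hf
  have h1 := (h ⊤ (by rw [AddSubgroup.index_top]; exact one_ne_zero)
    (fun _ _ _ => AddSubgroup.mem_top _) β hβ).1
  refine Summable.of_norm_bounded h1 fun x => ?_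
  by_cases hx : x ∈ S
  · rw [Set.indicator_of_mem hx, Set.indicator_of_mem]
    · rfl
    · exact ⟨fun _ => AddSubgroup.mem_top _, hS x hx⟩
  · rw [Set.indicator_of_notMem hx, norm_zero]
    exact Set.indicator_nonneg (fun _ _ => abs_nonneg _) x

omit [NumberField K] in
/-- The average over the lattices, as an average over the codes. -/
theorem averagePrimitiveSum_eq {F : Type*} [Field F] [Finite F]
    {φ : O →+* Matrix (Fin n) (Fin n) F} (hφ : Function.Surjective φ) {β : ℝ} (hβ : 0 < β)
    (f : EuclideanSpace ℝ (Fin d) → ℝ) :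
    averagePrimitiveSum {Λ | ∃ C ∈ codes F n t k, Λ = β • codeLattice ψ φ C} f =
      (∑ C ∈ (finite_codes (F := F) (n := n) (t := t) k).toFinset,
        ∑' x, (primitiveIn ψ φ β C).indicator (fun x => f (β • embed O ψ x)) x) /
        (codes F n t k).ncard := by
  have h1 : {Λ | ∃ C ∈ codes F n t k, Λ = β • codeLattice ψ φ C} =
      (fun C => β • codeLattice ψ φ C) '' codes F n t k := by
    ext Λ
    exact exists_congr fun C => and_congr_right fun _ => eq_comm
  have hinj := smul_codeLattice_injective (t := t) ψ φ hφ hβ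
  rw [averagePrimitiveSum, h1, Set.ncard_image_of_injective _ hinj,
    finsum_mem_image hinj.injOn, finsum_mem_eq_finite_toFinset_sum _ (finite_codes k)]
  congr 1
  exact Finset.sum_congr rfl fun C _ => tsum_primitiveVectors ψ φ hβ C f

/-- The weight of a vector of `O ^ t` in the average over the codes differs from the weight `P` of the
primitive vectors of full rank only for vectors of lower rank, and there by at most the proportion
of the codes that contain its reduction. -/
theorem IsOrderIn.abs_weight_sub_le (hO : IsOrderIn O) {F : Type*} [Field F] [Finite F]
    (φ : O →+* Matrix (Fin n) (Fin n) F) (hn : 0 < n) (hnk : n ≤ k) (hk : k ≤ n * t)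
    {β : ℝ} (hβ : 0 < β) (h : (Fin t → O) → ℝ) (x : Fin t → O) :
    |(∑ C ∈ (finite_codes (F := F) (n := n) (t := t) k).toFinset,
        (primitiveIn ψ φ β C).indicator h x) / (codes F n t k).ncard -
      codeDensity F (n * t) k n *
        {x : Fin t → O | embed O ψ x ∈ primitiveVectors (orderLattice O ψ)}.indicator h x| ≤
      ∑ r ∈ Finset.range n, codeDensity F (n * t) k r *
        {x : Fin t → O | reductionRank φ x = r ∧ x ≠ 0}.indicator (fun x => |h x|) x := by
  classical
  set s := (finite_codes (F := F) (n := n) (t := t) k).toFinset with hs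
  set M : ℝ := ((codes F n t k).ncard : ℝ) with hM
  set Q := {x : Fin t → O | embed O ψ x ∈ primitiveVectors (orderLattice O ψ)}
  have hM0 : 0 < M := Nat.cast_pos.2
    ((Set.ncard_pos (finite_codes k)).2 (nonempty_codes hk))
  have hnn : ∀ r ∈ Finset.range n, 0 ≤ codeDensity F (n * t) k r *
      {x : Fin t → O | reductionRank φ x = r ∧ x ≠ 0}.indicator (fun x => |h x|) x := fun r hr =>
    mul_nonneg (codeDensity_pos F ((Finset.mem_range.1 hr).le.trans hnk) hk).le
      (Set.indicator_nonneg (fun _ _ => abs_nonneg _) x)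
  rcases eq_or_ne x 0 with rfl | hx0
  · have h1 : ∀ C, (0 : Fin t → O) ∉ primitiveIn ψ φ β C := fun C hC =>
      ne_zero_of_mem_primitiveIn ψ hC rfl
    have h2 : (0 : Fin t → O) ∉ Q := fun h0 => h0.2.1 (map_zero _)
    rw [Finset.sum_eq_zero fun C _ => Set.indicator_of_notMem (h1 C) h,
      Set.indicator_of_notMem h2, zero_div, mul_zero, sub_zero, abs_zero]
    exact Finset.sum_nonneg hnn
  -- `w` is the proportion of the codes for which `x` is primitive.
  set w : ℝ := (s.filter fun C => x ∈ primitiveIn ψ φ β C).card / M with hw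
  set e : ℝ := if x ∈ Q then 1 else 0 with he
  have hsum : (∑ C ∈ s, (primitiveIn ψ φ β C).indicator h x) / M = w * h x := by
    simp only [Set.indicator_apply]
    rw [← Finset.sum_filter, Finset.sum_const, nsmul_eq_mul, hw]
    ring
  have hind : Q.indicator h x = e * h x := by
    rw [Set.indicator_apply, he]
    split_ifs <;> simp
  rw [hsum, hind, ← mul_assoc, ← sub_mul, abs_mul]
  set r := reductionRank φ x with hr
  have hrn : r ≤ n := reductionRank_le φ x
  have hdens : ((s.filter fun C => (fun j => φ (x j)) ∈ C).card : ℝ) / M =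
      codeDensity F (n * t) k r := by
    have h1 := ncard_codes_mem_mul hn hk hnk fun j => φ (x j)
    have h2 : {C ∈ codes F n t k | (fun j => φ (x j)) ∈ C}.ncard =
        (s.filter fun C => (fun j => φ (x j)) ∈ C).card := by
      rw [← Set.ncard_coe_finset, Finset.coe_filter]
      congr 1
      ext C
      simp [hs]
    rw [h2] at h1
    rw [codeDensity, div_eq_div_iff hM0.ne' (frameCount_pos F (by nlinarith)).ne', hr,
      reductionRank, h1, mul_comm]
  have hwle : w ≤ codeDensity F (n * t) k r := by
    rw [← hdens, hw]
    refine div_le_div_of_nonneg_right (Nat.cast_le.2 (Finset.card_le_card fun C hC => ?_)) hM0.le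
    rw [Finset.mem_filter] at hC ⊢
    exact ⟨hC.1, (smul_embed_mem ψ φ hβ).1 hC.2.1⟩
  have hw0 : 0 ≤ w := by positivity
  rcases hrn.lt_or_eq with hlt | heq
  · refine le_trans ?_ (Finset.single_le_sum hnn (Finset.mem_range.2 hlt))
    rw [Set.indicator_of_mem (by exact ⟨rfl, hx0⟩)]
    refine mul_le_mul_of_nonneg_right ?_ (abs_nonneg _)
    have h1 := codeDensity_anti F hrn hnk hk
    have h2 := codeDensity_pos F hnk hk
    have h3 : 0 ≤ codeDensity F (n * t) k n * e ∧
        codeDensity F (n * t) k n * e ≤ codeDensity F (n * t) k n := by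
      rw [he]
      split_ifs
      · rw [mul_one]; exact ⟨h2.le, le_rfl⟩
      · rw [mul_zero]; exact ⟨le_rfl, h2.le⟩
    rw [abs_le]
    constructor <;> linarith
  · have hx : (fun j => φ (x j)) ≠ 0 := by
      intro h0
      have h1 : r = 0 := by
        rw [hr, reductionRank, h0]
        have : flatten (0 : Fin t → Matrix (Fin n) (Fin n) F) = 0 := rfl
        rw [this, Matrix.rank_zero]
      omega
    have hweq : w = codeDensity F (n * t) k n * e := by
      rw [he]
      have hiff := fun C => hO.smul_embed_mem_primitiveVectors_iff ψ φ (C := C) hβ hx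
      split_ifs with hQ
      · have hdn : codeDensity F (n * t) k n = codeDensity F (n * t) k r := by rw [heq]
        rw [mul_one, hw, hdn, ← hdens]
        have hfilter : (s.filter fun C => x ∈ primitiveIn ψ φ β C) =
            s.filter fun C => (fun j => φ (x j)) ∈ C :=
          Finset.filter_congr fun C _ => (hiff C).trans (and_iff_left hQ)
        rw [hfilter]
      · rw [mul_zero, hw, Finset.filter_false_of_mem, Finset.card_empty, Nat.cast_zero, zero_div]
        intro C _ hC
        exact hQ ((hiff C).1 hC).2
    rw [hweq, sub_self, abs_zero, zero_mul]
    exact Finset.sum_nonneg hnn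

/-- The average over the codes is a multiple of the sum over the primitive vectors of `O ^ t`, up to
an error that is `O(1 / q)`. -/
theorem IsOrderIn.exists_average_bound (hO : IsOrderIn O) {κ : Type*} [Fintype κ] [Nonempty κ]
    (b : Module.Basis κ ℤ O) (hd : d = Fintype.card κ * t)
    {f : EuclideanSpace ℝ (Fin d) → ℝ} (hf : IsSemiAdmissible f)
    (hn : 0 < n) (hnk : n ≤ k) (hk : k ≤ n * t) :
    ∃ E : ℝ, ∀ (F : Type*) [Field F] [Finite F] (φ : O →+* Matrix (Fin n) (Fin n) F),
      Function.Surjective φ → ∀ β : ℝ, 0 < β →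
        β ^ d * (Nat.card F : ℝ) ^ (n * n * t) = (Nat.card F : ℝ) ^ (k * n) →
        |averagePrimitiveSum {Λ | ∃ C ∈ codes F n t k, Λ = β • codeLattice ψ φ C} f -
          codeDensity F (n * t) k n *
            ∑' x, {x : Fin t → O | embed O ψ x ∈ primitiveVectors (orderLattice O ψ)}.indicator
              (fun x => f (β • embed O ψ x)) x| ≤ E / Nat.card F := by
  obtain ⟨C₀, hC₀, hrank⟩ := hO.exists_rank_sum_bound ψ (n := n) b hd hf
  refine ⟨n * C₀, fun F _ _ φ hφ β hβ hβd => ?_⟩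
  have hq := one_lt_natCard (F := F)
  set q : ℝ := (Nat.card F : ℝ) with hqdef
  have hq0 : 0 < q := by linarith
  set h : (Fin t → O) → ℝ := fun x => f (β • embed O ψ x)
  set Q := {x : Fin t → O | embed O ψ x ∈ primitiveVectors (orderLattice O ψ)}
  have hsC : ∀ C, Summable ((primitiveIn ψ φ β C).indicator h) := fun C =>
    hO.summable_indicator ψ b hd hf hβ fun x hx => ne_zero_of_mem_primitiveIn ψ hx
  have hsQ : Summable (Q.indicator h) := hO.summable_indicator ψ b hd hf hβ
    fun x hx h0 => hx.2.1 (by rw [h0, map_zero])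
  rw [averagePrimitiveSum_eq ψ hφ hβ, ← Summable.tsum_finsetSum fun C _ => hsC C, ← tsum_div_const,
    ← tsum_mul_left, ← Summable.tsum_sub ((summable_sum fun C _ => hsC C).div_const _)
      (hsQ.mul_left _)]
  have hR : ∀ r ∈ Finset.range n, Summable fun x => codeDensity F (n * t) k r *
      {x : Fin t → O | reductionRank φ x = r ∧ x ≠ 0}.indicator (fun x => |h x|) x :=
    fun r hr => (hrank F φ hφ β hβ r (Finset.mem_range.1 hr).le).1.mul_left _
  have hbound := fun x => hO.abs_weight_sub_le ψ φ hn hnk hk hβ h x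
  rw [← Real.norm_eq_abs]
  simp only [← Real.norm_eq_abs] at hbound
  refine (tsum_of_norm_bounded (summable_sum hR).hasSum fun x => ?_).trans ?_
  · simpa only [Real.norm_eq_abs] using hbound x
  rw [Summable.tsum_finsetSum hR]
  have hterm : ∀ r ∈ Finset.range n, ∑' x, codeDensity F (n * t) k r *
      {x : Fin t → O | reductionRank φ x = r ∧ x ≠ 0}.indicator (fun x => |h x|) x ≤ C₀ / q := by
    intro r hr
    have hrn := Finset.mem_range.1 hr
    rw [tsum_mul_left]
    have h1 := (hrank F φ hφ β hβ r hrn.le).2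
    have h2 := codeDensity_mul_le F (hrn.le.trans hnk) hk
    rw [← hqdef] at h1 h2
    set T := ∑' x, {x : Fin t → O | reductionRank φ x = r ∧ x ≠ 0}.indicator (fun x => |h x|) x
    set D := codeDensity F (n * t) k r
    have hD : 0 < D := codeDensity_pos F (hrn.le.trans hnk) hk
    have hT : 0 ≤ T := tsum_nonneg fun x => Set.indicator_nonneg (fun _ _ => abs_nonneg _) x
    have hβpos : 0 < β ^ d := by positivity
    -- After cancellation, the exponents of `q` satisfy this because `1 ≤ (n - r) * (k - r)`.
    have hexp : q ^ (k * r) * q * q ^ (r * n) * q ^ (n * n * t) ≤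
        q ^ (r * r) * q ^ (n * t * r) * (q ^ (k * n) * q ^ ((n - r) * n * t)) := by
      rw [← pow_succ, ← pow_add, ← pow_add, ← pow_add, ← pow_add, ← pow_add]
      refine pow_le_pow_right₀ hq.le ?_
      obtain ⟨a, rfl⟩ := Nat.exists_eq_add_of_lt hrn
      obtain ⟨c, rfl⟩ := Nat.exists_eq_add_of_le hnk
      rw [show r + a + 1 - r = a + 1 by omega]
      nlinarith [Nat.zero_le (a * a), Nat.zero_le (a * c)]
    rw [← hβd] at hexp
    rw [le_div_iff₀ hq0]
    have hX : 0 < q ^ (r * r) * q ^ (n * t * r) * (β ^ d * q ^ ((n - r) * n * t)) := by positivity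
    refine le_of_mul_le_mul_right ?_ hX
    calc D * T * q * (q ^ (r * r) * q ^ (n * t * r) * (β ^ d * q ^ ((n - r) * n * t)))
        = (D * q ^ (n * t * r)) * ((T * q ^ (r * r)) * (β ^ d * q ^ ((n - r) * n * t))) * q := by
          ring
      _ ≤ q ^ (k * r) * ((C₀ * q ^ (r * n) * (β ^ d * q ^ ((n - r) * n * t))⁻¹) *
            (β ^ d * q ^ ((n - r) * n * t))) * q := by gcongr
      _ = C₀ * (q ^ (k * r) * q * q ^ (r * n)) := by field_simp
      _ ≤ C₀ * (q ^ (r * r) * q ^ (n * t * r) * (β ^ d * q ^ ((n - r) * n * t))) := by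
          refine mul_le_mul_of_nonneg_left ?_ hC₀.le
          refine le_of_mul_le_mul_right (hexp.trans_eq ?_)
            (show 0 < q ^ (n * n * t) by positivity)
          ring
  refine (Finset.sum_le_sum hterm).trans_eq ?_
  rw [Finset.sum_const, Finset.card_range, nsmul_eq_mul, mul_div_assoc]

end Average

/-! ### The limit -/

section Limit

variable {K A : Type*} [Field K] [NumberField K] [DivisionRing A] [Algebra K A] [Algebra ℚ A]
  {O : Subalgebra (𝓞 K) A} {t d n k : ℕ}
  (ψ : (Fin t → ℝ ⊗[ℚ] A) ≃ₗ[ℝ] EuclideanSpace ℝ (Fin d))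

/-- The sum over the primitive vectors of `O ^ t`, scaled to covolume `1 / β ^ d`, converges. -/
theorem IsOrderIn.tendsto_primitive_sum (hO : IsOrderIn O) (hd : 1 < d)
    {f : EuclideanSpace ℝ (Fin d) → ℝ} (hf : IsSemiAdmissible f) :
    Tendsto (fun β : ℝ => β ^ d *
        ∑' x, {x : Fin t → O | embed O ψ x ∈ primitiveVectors (orderLattice O ψ)}.indicator
          (fun x => f (β • embed O ψ x)) x)
      (𝓝[>] 0)
      (𝓝 (((riemannZeta (d : ℂ)).re * ZLattice.covolume (orderLattice O ψ))⁻¹ * ∫ x, f x)) := by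
  have := hO.module_finite_int
  have := module_free_int (O := O)
  obtain ⟨B, hB⟩ := hO.exists_real_basis ψ (Module.Free.chooseBasis ℤ O)
  have hL := orderLattice_eq_span ψ _ hB
  have h := CodeLift.tendsto_primitive_sum B hd hf
  rw [← hL] at h
  refine h.congr fun β => ?_
  rw [← (Equiv.ofBijective (fun x : Fin t → O => (⟨embed O ψ x, x, rfl⟩ : orderLattice O ψ))
      ⟨fun x y hxy => embed_injective ψ (congrArg Subtype.val hxy),
        fun ⟨_, x, hx⟩ => ⟨x, Subtype.ext hx⟩⟩).tsum_eq]
  rfl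

/-- The averages over the code lattices of covolume `V` converge along any family of surjections
onto matrix rings over finite fields whose cardinality tends to infinity. -/
theorem IsOrderIn.tendsto_averagePrimitiveSum (hO : IsOrderIn O) {κ : Type*} [Fintype κ]
    [Nonempty κ] (b : Module.Basis κ ℤ O) (hd : d = Fintype.card κ * t)
    {f : EuclideanSpace ℝ (Fin d) → ℝ} (hf : IsSemiAdmissible f)
    (hn : 0 < n) (hnk : n ≤ k) (hk : k < n * t) (ht : 2 ≤ t)
    {α : Type*} {l : Filter α} (F : α → Type*) [∀ a, Field (F a)] [∀ a, Finite (F a)]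
    (φ : ∀ a, O →+* Matrix (Fin n) (Fin n) (F a)) (hφ : ∀ a, Function.Surjective (φ a))
    (β : α → ℝ) (hβ : ∀ a, 0 < β a)
    (hβd : ∀ a, β a ^ d * (Nat.card (F a) : ℝ) ^ (n * n * t) = (Nat.card (F a) : ℝ) ^ (k * n))
    (hq : Tendsto (fun a => (Nat.card (F a) : ℝ)) l atTop) :
    Tendsto (fun a => averagePrimitiveSum
        {Λ | ∃ C ∈ codes (F a) n t k, Λ = β a • codeLattice ψ (φ a) C} f) l
      (𝓝 (((riemannZeta (d : ℂ)).re * ZLattice.covolume (orderLattice O ψ))⁻¹ * ∫ x, f x)) := by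
  have hd1 : 1 < d := by
    have : 0 < Fintype.card κ := Fintype.card_pos
    nlinarith
  have hq0 : ∀ a, (0 : ℝ) < Nat.card (F a) := fun a => zero_lt_one.trans one_lt_natCard
  have hβ0 : Tendsto β l (𝓝[>] 0) := by
    refine tendsto_nhdsWithin_iff.2 ⟨?_, Eventually.of_forall hβ⟩
    have h1 : Tendsto (fun a => ((Nat.card (F a) : ℝ) ^ (n * n * t - k * n))⁻¹) l (𝓝 0) :=
      tendsto_inv_atTop_zero.comp ((tendsto_pow_atTop (by
        have : k * n < n * n * t := by nlinarith
        omega)).comp hq)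
    have h2 := h1.rpow_const (p := (d : ℝ)⁻¹) (Or.inr (by positivity))
    rw [Real.zero_rpow (by positivity)] at h2
    refine h2.congr fun a => ?_
    have h3 : ((Nat.card (F a) : ℝ) ^ (n * n * t - k * n))⁻¹ = β a ^ d := by
      rw [eq_comm, ← mul_left_inj' (pow_ne_zero (n * n * t) (hq0 a).ne'), hβd, inv_mul_eq_div,
        eq_div_iff (pow_ne_zero _ (hq0 a).ne'), ← pow_add]
      congr 1
      have : k * n ≤ n * n * t := by nlinarith
      omega
    rw [h3, Real.pow_rpow_inv_natCast (hβ a).le (by omega)]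
  obtain ⟨E, hE⟩ := hO.exists_average_bound ψ b hd hf hn hnk hk.le
  have hmain := ((tendsto_codeDensity F hq hnk hk.le).mul
    ((hO.tendsto_primitive_sum ψ hd1 hf).comp hβ0))
  rw [one_mul] at hmain
  have herr : Tendsto (fun a => E / (Nat.card (F a) : ℝ)) l (𝓝 0) := hq.const_div_atTop E
  have hdiff := squeeze_zero_norm (fun a => (Real.norm_eq_abs _).trans_le
    (hE (F a) (φ a) (hφ a) (β a) (hβ a) (hβd a))) herr
  have hsum := hdiff.add hmain
  rw [zero_add] at hsum
  refine hsum.congr fun a => ?_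
  have h4 : (Nat.card (F a) : ℝ) ^ (n * t * n) / (Nat.card (F a) : ℝ) ^ (k * n) * β a ^ d = 1 := by
    rw [div_mul_eq_mul_div, div_eq_one_iff_eq (pow_ne_zero _ (hq0 a).ne'), ← hβd a, mul_comm,
      show n * t * n = n * n * t by ring]
  rw [Function.comp_apply, ← mul_assoc, mul_assoc (codeDensity _ _ _ _), h4, mul_one,
    sub_add_cancel]

end Limit

/-- The scaling factor normalises the covolume. -/
theorem scaling_pow (F : Type*) [Field F] [Finite F] {n m t : ℕ} (hd : 0 < n ^ 2 * m * t) (k : ℕ) :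
    scaling F n m t k ^ (n ^ 2 * m * t) * (Nat.card F : ℝ) ^ (n * n * t) =
      (Nat.card F : ℝ) ^ (k * n) := by
  have hq : (0 : ℝ) < Nat.card F := zero_lt_one.trans one_lt_natCard
  have hd' : ((n : ℝ) ^ 2 * m * t) ≠ 0 := by exact_mod_cast hd.ne'
  have h : ((n : ℝ) * k - (n : ℝ) ^ 2 * t) / ((n : ℝ) ^ 2 * m * t) * ((n ^ 2 * m * t : ℕ) : ℝ) +
      ((n * n * t : ℕ) : ℝ) = ((k * n : ℕ) : ℝ) := by
    push_cast
    rw [div_mul_cancel₀ _ hd']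
    ring
  rw [scaling, ← Real.rpow_mul_natCast hq.le, ← Real.rpow_natCast _ (n * n * t),
    ← Real.rpow_natCast _ (k * n), ← Real.rpow_add hq, h]

theorem scaling_pos (F : Type*) [Field F] [Finite F] (n m t k : ℕ) : 0 < scaling F n m t k :=
  Real.rpow_pos_of_pos (zero_lt_one.trans one_lt_natCard) _

end CodeLift

end

theorem theorem3p6
    {K A : Type*} [Field K] [NumberField K] [DivisionRing A] [Algebra ℚ A] [Algebra K A]
    [FiniteDimensional K A] [Algebra.IsCentral K A]
    (n m t k : ℕ) (hn : Module.finrank K A = n ^ 2) (hm : Module.finrank ℚ K = m) (ht : 2 ≤ t)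
    (hk₁ : (n - 1) * t < k) (hk₂ : k < n * t)
    (O : Subalgebra (𝓞 K) A) (hO : CodeLift.IsOrderIn O)
    (P : Set (IsDedekindDomain.HeightOneSpectrum (𝓞 K))) (hP : P.Infinite)
    (φ : ∀ 𝔭 : P, O →+* Matrix (Fin n) (Fin n) (𝓞 K ⧸ 𝔭.1.asIdeal))
    (hφ : ∀ 𝔭 : P, CodeLift.IsReductionMap (φ 𝔭))
    (ψ : (Fin t → ℝ ⊗[ℚ] A) ≃ₗ[ℝ] EuclideanSpace ℝ (Fin (n ^ 2 * m * t)))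
    (f : EuclideanSpace ℝ (Fin (n ^ 2 * m * t)) → ℝ) (hf : CodeLift.IsSemiAdmissible f) :
    Integrable f ∧
    (∀ 𝔭 : P,
      (CodeLift.liftedLattices m k ψ (φ 𝔭)).Finite ∧
      (CodeLift.liftedLattices m k ψ (φ 𝔭)).Nonempty ∧
      ∀ Λ ∈ CodeLift.liftedLattices m k ψ (φ 𝔭),
        ZLattice.covolume Λ = ZLattice.covolume (CodeLift.orderLattice O ψ) ∧
        Summable fun x : CodeLift.primitiveVectors Λ => f x) ∧
    ∃ L : ℝ,
      Tendsto
        (fun 𝔭 : P => CodeLift.averagePrimitiveSum (CodeLift.liftedLattices m k ψ (φ 𝔭)) f)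
        (comap (fun 𝔭 : P => ringChar (𝓞 K ⧸ 𝔭.1.asIdeal)) atTop) (𝓝 L) ∧
      L ≤ ((riemannZeta ((n ^ 2 * m * t : ℕ) : ℂ)).re *
            ZLattice.covolume (CodeLift.orderLattice O ψ))⁻¹ * ∫ x, f x := by
  have hn0 : 0 < n := by
    have h : 0 < Module.finrank K A := Module.finrank_pos
    rw [hn] at h
    exact Nat.pos_of_ne_zero fun h0 => by simp [h0] at h
  have hm0 : 0 < m := hm ▸ Module.finrank_pos
  have hd0 : 0 < n ^ 2 * m * t := by positivity
  -- `(n - 1) * t < k` together with `2 ≤ t` leaves room for a code that contains a tuple of full rank.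
  have hnk : n ≤ k := by
    obtain ⟨a, rfl⟩ : ∃ a, n = a + 1 := ⟨n - 1, by omega⟩
    rw [Nat.add_sub_cancel] at hk₁
    nlinarith
  have := hO.module_finite_int
  have := CodeLift.module_free_int (O := O)
  have b := Module.Free.chooseBasis ℤ O
  have hcard : n ^ 2 * m * t = Fintype.card (Module.Free.ChooseBasisIndex ℤ O) * t := by
    obtain ⟨bA, -⟩ := hO.exists_rat_basis b
    have : IsScalarTower ℚ K A := inferInstance
    rw [← Module.finrank_eq_card_basis bA, ← Module.finrank_mul_finrank ℚ K A, hn, hm]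
    ring
  have : Nonempty (Module.Free.ChooseBasisIndex ℤ O) := Fintype.card_pos_iff.1
    (Nat.pos_of_ne_zero fun h0 => by rw [h0] at hcard; omega)
  let : ∀ 𝔭 : P, Field (𝓞 K ⧸ 𝔭.1.asIdeal) := fun 𝔭 =>
    haveI := 𝔭.1.isMaximal
    Ideal.Quotient.field 𝔭.1.asIdeal
  have hfin : ∀ 𝔭 : P, Finite (𝓞 K ⧸ 𝔭.1.asIdeal) := fun 𝔭 =>
    Ideal.finiteQuotientOfFreeOfNeBot _ 𝔭.1.ne_bot
  have hβ : ∀ 𝔭 : P, 0 < CodeLift.scaling (𝓞 K ⧸ 𝔭.1.asIdeal) n m t k := fun 𝔭 =>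
    CodeLift.scaling_pos _ n m t k
  have hβd := fun 𝔭 : P => CodeLift.scaling_pow (𝓞 K ⧸ 𝔭.1.asIdeal) hd0 k
  -- The averages converge to the right-hand side itself.
  refine ⟨hf.integrable, fun 𝔭 => ⟨?_, ?_, ?_⟩, _, ?_, le_rfl⟩
  · refine ((CodeLift.finite_codes (F := 𝓞 K ⧸ 𝔭.1.asIdeal) (n := n) (t := t) k).image fun C =>
      CodeLift.scaling (𝓞 K ⧸ 𝔭.1.asIdeal) n m t k • CodeLift.codeLattice ψ (φ 𝔭) C).subset ?_
    rintro _ ⟨C, hC, rfl⟩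
    exact ⟨C, hC, rfl⟩
  · obtain ⟨C, hC⟩ := CodeLift.nonempty_codes (F := 𝓞 K ⧸ 𝔭.1.asIdeal) hk₂.le
    exact ⟨_, C, hC, rfl⟩
  · rintro _ ⟨C, hC, rfl⟩
    constructor
    · have h := hO.covolume_codeLattice ψ (φ 𝔭) (hφ 𝔭).surjective hC (hβ 𝔭)
      rw [hβd, mul_comm] at h
      exact mul_left_cancel₀
        (pow_ne_zero _ (zero_lt_one.trans CodeLift.one_lt_natCard).ne') h
    · exact (CodeLift.summable_primitiveVectors_iff ψ (φ 𝔭) (hβ 𝔭) C f).2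
        (hO.summable_indicator ψ b hcard hf (hβ 𝔭) fun x hx =>
          CodeLift.ne_zero_of_mem_primitiveIn ψ hx)
  · refine hO.tendsto_averagePrimitiveSum ψ b hcard hf hn0 hnk hk₂ ht
      (fun 𝔭 : P => 𝓞 K ⧸ 𝔭.1.asIdeal) φ (fun 𝔭 => (hφ 𝔭).surjective)
      (fun 𝔭 => CodeLift.scaling (𝓞 K ⧸ 𝔭.1.asIdeal) n m t k) hβ hβd ?_
    refine tendsto_natCast_atTop_atTop.comp
      (tendsto_atTop_mono (fun 𝔭 => ?_) tendsto_comap)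
    -- The characteristic of a finite ring divides its cardinality.
    have := Fintype.ofFinite (𝓞 K ⧸ 𝔭.1.asIdeal)
    refine Nat.le_of_dvd Nat.card_pos (ringChar.dvd ?_)
    rw [Nat.card_eq_fintype_card, Nat.cast_card_eq_zero]
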